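/- Let $K>k\ge 1$ be integers. A $(K+1,k+1)$-regular bigraph is a finite connected simple bipartite graph $X=(L\sqcup R,E)$ in which every vertex of $L$ has degree $K+1$ and every vertex of $R$ has degree $k+1$; put $n=|L|$ and let $N=n(K+1)$ be the number of directed edges from $L$ to $R$. Let $B_X$ be the non-backtracking operator on complex functions on the directed edges, $(B_Xf)(v\to u)=\sum_{w\sim u,\,w\ne v}f(u\to w)$. Call $X$ *Ramanujan* if every eigenvalue of $B_X$ other than $\pm\sqrt{Kk}$ lies in $\{z\in\mathbb C: |z|=(Kk)^{1/4}\}\cup\{\pm i\sqrt k,\pm1\}$ (the spectrum of the non-backtracking operator of the $(K+1,k+1)$-biregular tree). The non-backtracking random walk (NBRW) moves from a directed edge $v\to w$ to a uniformly random edge $w\to u$ with $u\ne v$; the simple random walk (SRW) moves from a vertex to a uniformly random neighbour. For either walk, $t_{mix}(\varepsilon,X)$ is the least even $s\ge 0$ such that, for every starting point, the law of the walk at time $s$ has total variation distance less than $\varepsilon$ from the uniform distribution on the points on the same side as the starting point (for the NBRW: the directed edges with the same orientation, $L\to R$ or $R\to L$; for the SRW: $L$ or $R$). Consider the family of all $(K+1,k+1)$-regular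 Ramanujan bigraphs; limits, $o(\cdot)$, $O(\cdot)$ and "large enough" refer to $N\to\infty$ (equivalently $n\to\infty$), uniformly over the graphs of the family, with $K,k$ fixed. The family exhibits cutoff if $t_{mix}(\varepsilon,X)/t_{mix}(1-\varepsilon,X)\to1$ for every $0<\varepsilon<1$. The cutoff occurs at time $t(X)$ with window $w(X,\varepsilon)$ if for every $0<\varepsilon<1$ one has $w(X,\varepsilon)=o(t(X))$ and $|t_{mix}(\varepsilon,X)-t(X)|\le w(X,\varepsilon)$ once $X$ is large enough (depending on $\varepsilon$). Then: 1. The NBRW exhibits cutoff, and for every $b>1$ the cutoff occurs at time $\log_{\sqrt{Kk}}N$ with window $3\log_{\sqrt{Kk}}\log_b N$. 2. The SRW exhibits cutoff, and the cutoff occurs at time $\frac{(K+1)(k+1)}{Kk-1}\log_{\sqrt{Kk}}n$ with a window $w(X,\varepsilon)$ satisfying $w(X,\varepsilon)=O(\sqrt{\log n})$ for every fixed $0<\varepsilon<1$ (the implied constant may depend on $\varepsilon,K,k$ only). -/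

import Mathlib

open Filter Topology Asymptotics

universe u

/-! ### Finite Markov chains observed at even times -/

section Walks

/-- Total variation distance `½‖μ - ν‖₁` between two distributions on a finite set. -/
noncomputable def tvDist {α : Type u} [Fintype α] (μ ν : α → ℝ) : ℝ :=
  (1 / 2) * ∑ a, |μ a - ν a|

/-- The uniform distribution on a finite set `S`. -/
noncomputable def uniformOn {α : Type u} [DecidableEq α] (S : Finset α) : α → ℝ :=
  fun a => if a ∈ S then (S.card : ℝ)⁻¹ else 0

/-- The `ε`-mixing time, restricted to even times, of a chain with transition matrix `P` which
changes at every step the value of `side`: the least even time `s` such that from every starting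
point `a₀` the law at time `s` (the row `a₀` of `P ^ s`) is at total variation distance less than
`ε` from the uniform distribution on the points lying on the same side as `a₀`. -/
noncomputable def evenMixingTime {α : Type u} [Fintype α] [DecidableEq α]
    (P : Matrix α α ℝ) (side : α → Bool) (ε : ℝ) : ℕ :=
  sInf {s : ℕ | Even s ∧
    ∀ a₀ : α, tvDist ((P ^ s) a₀) (uniformOn {a | side a = side a₀}) < ε}

variable {V : Type u} [Fintype V] [DecidableEq V] (G : SimpleGraph V) [DecidableRel G.Adj]

/-- Transition matrix of the simple random walk on the vertices: move to a uniform neighbour. -/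
noncomputable def srwMatrix : Matrix V V ℝ :=
  Matrix.of fun v w => if G.Adj v w then (G.degree v : ℝ)⁻¹ else 0

/-- Transition matrix of the non-backtracking random walk on the directed edges: from `v → w` move
to a uniform edge `w → u` with `u ≠ v` (there are `deg w - 1` of these). -/
noncomputable def nbrwMatrix : Matrix G.Dart G.Dart ℝ :=
  Matrix.of fun e e' =>
    if e.snd = e'.fst ∧ e'.snd ≠ e.fst then ((G.degree e.snd : ℝ) - 1)⁻¹ else 0

/-- The non-backtracking operator on functions on directed edges,
`(B f)(v → u) = ∑_{w ∼ u, w ≠ v} f(u → w)`, as a matrix. -/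
def nbMatrix : Matrix G.Dart G.Dart ℂ :=
  Matrix.of fun e e' => if e.snd = e'.fst ∧ e'.snd ≠ e.fst then 1 else 0

end Walks

/-! ### Biregular bipartite graphs -/

/-- A finite connected bipartite graph with sides `L`, `R`, in which every vertex of `L` has degree
`K + 1` and every vertex of `R` has degree `k + 1`. -/
structure Bigraph (K k : ℕ) where
  L : Type u
  R : Type u
  [fintypeL : Fintype L]
  [fintypeR : Fintype R]
  [decEqL : DecidableEq L]
  [decEqR : DecidableEq R]
  graph : SimpleGraph (L ⊕ R)
  [decAdj : DecidableRel graph.Adj]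
  bipartite : graph ≤ completeBipartiteGraph L R
  connected : graph.Connected
  degree_left : ∀ l : L, graph.degree (Sum.inl l) = K + 1
  degree_right : ∀ r : R, graph.degree (Sum.inr r) = k + 1

namespace Bigraph

attribute [instance] Bigraph.fintypeL Bigraph.fintypeR Bigraph.decEqL Bigraph.decEqR Bigraph.decAdj

variable {K k : ℕ} (X : Bigraph.{u} K k)

/-- The size `n` of the left side. -/
def leftCard : ℕ := Fintype.card X.L

/-- The number `N` of directed edges going from left to right. -/
def edgeCard : ℕ := ({e | e.fst.isLeft = true} : Finset X.graph.Dart).card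

/-- `X` is Ramanujan: every eigenvalue of the non-backtracking operator of `X` other than the
trivial ones `±√(Kk)` lies in the spectrum of the non-backtracking operator of the
`(K+1,k+1)`-biregular tree, i.e. in `{|z| = (Kk)^{1/4}} ∪ {±i√k, ±1}`. -/
def IsRamanujan : Prop :=
  spectrum ℂ (nbMatrix X.graph) \ {((√(K * k) : ℝ) : ℂ), -((√(K * k) : ℝ) : ℂ)} ⊆
    {z : ℂ | ‖z‖ = ((K : ℝ) * k) ^ (1 / 4 : ℝ)} ∪
      {Complex.I * ((√k : ℝ) : ℂ), -(Complex.I * ((√k : ℝ) : ℂ)), 1, -1}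

/-- Even-time mixing time of the non-backtracking random walk; the two sides are the directed
edges from left to right and those from right to left. -/
noncomputable def nbrwMixingTime (ε : ℝ) : ℕ :=
  evenMixingTime (nbrwMatrix X.graph) (fun e => e.fst.isLeft) ε

/-- Even-time mixing time of the simple random walk. -/
noncomputable def srwMixingTime (ε : ℝ) : ℕ :=
  evenMixingTime (srwMatrix X.graph) (fun v => v.isLeft) ε

end Bigraph

/-- The family of all `(K+1,k+1)`-regular Ramanujan bigraphs. -/
def RamanujanBigraph (K k : ℕ) : Type (u + 1) := {X : Bigraph.{u} K k // X.IsRamanujan}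

/-- The filter of large graphs: a property holds eventually iff there is a bound such that it holds
for every Ramanujan bigraph whose number `N` of edges is at least that bound. -/
def largeGraphs (K k : ℕ) : Filter (RamanujanBigraph.{u} K k) :=
  comap (fun X => X.1.edgeCard) atTop

/-! ### Cutoff for a family, with limits taken along a filter on the index set -/

/-- `t_mix(ε) / t_mix(1 - ε) → 1` for every `0 < ε < 1`. -/
def ExhibitsCutoff {ι : Type*} (l : Filter ι) (tmix : ℝ → ι → ℕ) : Prop :=
  ∀ ε : ℝ, 0 < ε → ε < 1 →
    Tendsto (fun i => (tmix ε i : ℝ) / (tmix (1 - ε) i : ℝ)) l (𝓝 1)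

/-- Cutoff occurs at time `t` with window `w`: for every `0 < ε < 1` one has `w(·, ε) = o(t)`, and
`|t_mix(ε) - t| ≤ w(·, ε)` eventually. -/
def CutoffAt {ι : Type*} (l : Filter ι) (tmix : ℝ → ι → ℕ) (t : ι → ℝ) (w : ℝ → ι → ℝ) : Prop :=
  ∀ ε : ℝ, 0 < ε → ε < 1 →
    w ε =o[l] t ∧ ∀ᶠ i in l, |(tmix ε i : ℝ) - t i| ≤ w ε i

/-! Index the edges of the graph by pairs (left end, right end). One non-backtracking step is then
either `a` (move to another edge with the same right end) or `b` (another edge with the same left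
end), and two steps are `a * b` or `b * a`. Both matrices are symmetric and satisfy Hecke relations:
`a` has possible eigenvalues k, -1, and `b` has K, -1. Put T = ab and q = √(Kk). The operator Z = T
+ q² T⁻¹ is a polynomial in a and b, is symmetric, and commutes with T. On each eigenspace of Z, T
therefore satisfies T² = zT - q². Either both roots have modulus q, or they are real and distinct,
and then the Ramanujan condition rules out the larger one. Although T is not normal, this gives
‖T^m‖ = O(m q^m) on sum-zero functions, the linear factor being the only price of non-normality. See
`norm_pow_apply_le_of_hecke_pair`.

For the non-backtracking walk, Cauchy–Schwarz turns this into a total variation bound of order √N ·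
m · q^(-m) at time 2m, small slightly beyond log_q N. Conversely, at time 2m every positive
transition probability is at least q^(-2m), so the support has at most q^(2m) edges and the walk
cannot be mixed much before log_q N.

For the simple walk, lift to the biregular tree. Conditionally on its distance d from the root
there, the walk is at the end of a uniform non-backtracking path of length d
(`srwMatrix_pow_apply`). The distance is a nearest-neighbour chain on ℕ of speed ν =
(Kk-1)/((K+1)(k+1)), with variance linear in time. So the walk mixes when the distance passes log_q
n, that is at time ν⁻¹ log_q n, and Chebyshev's inequality gives a window of order √(log n). -/

section PowerBounds

/-! ### Powers of a product of two Hecke operators. -/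

variable {H : Type*} [NormedAddCommGroup H] [InnerProductSpace ℝ H]

/-- An operator commuting with a symmetric one is bounded by its norms on the eigenspaces. -/
theorem norm_apply_le_of_commute_symmetric [FiniteDimensional ℝ H] {Z S : Module.End ℝ H}
    (hZ : Z.IsSymmetric) (hc : ∀ x, S (Z x) = Z (S x)) {c : ℝ} (hc0 : 0 ≤ c)
    (hS : ∀ (z : ℝ) (x : H), Z x = z • x → ‖S x‖ ≤ c * ‖x‖) (x : H) : ‖S x‖ ≤ c * ‖x‖ := by
  classical
  set w := hZ.diagonalization x with hw
  have hx : x = ∑ μ, (w μ : H) := by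
    rw [← hZ.diagonalization_symm_apply, hw, LinearIsometryEquiv.symm_apply_apply]
  have hZw : ∀ μ, Z (w μ : H) = (μ : ℝ) • (w μ : H) := fun μ =>
    Module.End.mem_eigenspace_iff.1 (w μ).2
  have hmem : ∀ μ : Module.End.Eigenvalues Z,
      S (w μ : H) ∈ Module.End.eigenspace Z (μ : ℝ) := fun μ => by
    rw [Module.End.mem_eigenspace_iff, ← hc, hZw, map_smul]
  have h1 := hZ.orthogonalFamily_eigenspaces'.norm_sum
    (fun μ => (⟨S (w μ : H), hmem μ⟩ : Module.End.eigenspace Z (μ : ℝ))) Finset.univ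
  have h2 := hZ.orthogonalFamily_eigenspaces'.norm_sum (fun μ => w μ) Finset.univ
  change ‖∑ μ, (w μ : H)‖ ^ 2 = _ at h2
  change ‖∑ μ, S (w μ : H)‖ ^ 2 = ∑ μ, ‖S (w μ : H)‖ ^ 2 at h1
  rw [← hx] at h2
  rw [← map_sum, ← hx] at h1
  refine abs_le_of_sq_le_sq' ?_ (by positivity) |>.2
  rw [h1, mul_pow, h2, Finset.mul_sum]
  refine Finset.sum_le_sum fun μ _ => ?_
  rw [← mul_pow]
  exact pow_le_pow_left₀ (norm_nonneg _) (hS μ _ (hZw μ)) 2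

/-- Powers on a vector satisfying a quadratic relation with complex roots of modulus `q`. -/
theorem norm_pow_apply_le_of_quadratic {T : Module.End ℝ H} {q z : ℝ} (hq : 0 < q)
    (hz : |z| ≤ 2 * q) {x : H} (hT : ∀ m : ℕ, (T ^ (m + 2)) x = z • (T ^ (m + 1)) x -
      q ^ 2 • (T ^ m) x) (hb : ‖T x‖ ≤ q ^ 2 * ‖x‖) (m : ℕ) :
    ‖(T ^ m) x‖ ≤ (q + 1) * (m + 1) * q ^ m * ‖x‖ := by
  -- The conjugate roots z/2 ± i√(4q² - z²)/2 of X² - zX + q².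
  obtain ⟨α, β, hαβ, hsum, hα, hβ⟩ : ∃ α β : ℂ, α * β = (q : ℂ) ^ 2 ∧ α + β = z ∧
      ‖α‖ = q ∧ ‖β‖ = q := by
    set d := √(4 * q ^ 2 - z ^ 2) with hd
    have hd2 : d ^ 2 = 4 * q ^ 2 - z ^ 2 := by
      rw [hd, Real.sq_sqrt]
      nlinarith [sq_abs z, abs_nonneg z]
    have hn : ∀ e : ℝ, e ^ 2 = d ^ 2 → ‖(⟨z / 2, e / 2⟩ : ℂ)‖ = q := fun e he => by
      rw [← sq_eq_sq₀ (norm_nonneg _) hq.le, ← Complex.normSq_eq_norm_sq, Complex.normSq_mk]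
      linarith
    refine ⟨⟨z / 2, d / 2⟩, ⟨z / 2, (-d) / 2⟩, ?_, ?_, hn _ rfl, hn _ (by ring)⟩
    · apply Complex.ext
      · simp [pow_two]
        nlinarith
      · simp [pow_two]
        ring
    · apply Complex.ext <;> simp
      ring
  -- Here s = ∑ α^i β^(m-i) over 0 ≤ i ≤ m, and t is the same sum for m - 1. Both are real, and the
  -- m + 1 terms of modulus q^m give the linear growth; this form also covers a double root α = β.
  have key : ∀ m : ℕ, ∃ s t : ℝ, (T ^ (m + 1)) x = s • T x - (q ^ 2 * t) • x ∧
      (T ^ (m + 2)) x = (z * s - q ^ 2 * t) • T x - (q ^ 2 * s) • x ∧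
      (s : ℂ) = α * t + β ^ m ∧ q * |t| ≤ m * q ^ m := by
    intro m
    induction m with
    | zero =>
      refine ⟨1, 0, by simp, ?_, by simp, by simp⟩
      rw [hT 0]
      simp
    | succ m ih =>
      obtain ⟨s, t, h1, h2, h3, h4⟩ := ih
      refine ⟨z * s - q ^ 2 * t, s, h2, ?_, ?_, ?_⟩
      · rw [hT (m + 1), h1, h2]
        module
      · push_cast
        rw [← hsum, ← hαβ, pow_succ]
        linear_combination (β : ℂ) * h3
      · have : |s| ≤ q * |t| + q ^ m := by
          have := norm_add_le (α * t) (β ^ m)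
          rw [← h3, norm_mul, norm_pow, hα, hβ] at this
          simpa using this
        push_cast
        have : q * |s| ≤ q * (q * |t| + q ^ m) := mul_le_mul_of_nonneg_left this hq.le
        calc q * |s| ≤ q * (m * q ^ m + q ^ m) := by nlinarith
          _ = _ := by ring
  cases m with
  | zero => simp; nlinarith [norm_nonneg x]
  | succ m =>
    obtain ⟨s, t, h1, -, h3, h4⟩ := key m
    have hs : |s| ≤ (m + 1) * q ^ m := by
      have := norm_add_le (α * t) (β ^ m)
      rw [← h3, norm_mul, norm_pow, hα, hβ] at this
      have h5 : |s| ≤ q * |t| + q ^ m := by simpa using this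
      linarith
    have hx := norm_nonneg x
    have hqm : 0 < q ^ m := by positivity
    rw [h1]
    calc ‖s • T x - (q ^ 2 * t) • x‖ ≤ |s| * ‖T x‖ + q * (q * |t|) * ‖x‖ := by
          refine (norm_sub_le _ _).trans (le_of_eq ?_)
          rw [norm_smul, norm_smul, Real.norm_eq_abs, Real.norm_eq_abs, abs_mul,
            abs_of_pos (by positivity : 0 < q ^ 2)]
          ring
      _ ≤ ((m + 1) * q ^ m) * (q ^ 2 * ‖x‖) + q * (m * q ^ m) * ‖x‖ := by
          gcongr
      _ ≤ (q + 1) * ((m + 1 : ℕ) + 1) * q ^ (m + 1) * ‖x‖ := by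
          push_cast
          rw [← sub_nonneg]
          have : (q + 1) * ((m : ℝ) + 1 + 1) * q ^ (m + 1) * ‖x‖ -
              ((m + 1) * q ^ m * (q ^ 2 * ‖x‖) + q * (m * q ^ m) * ‖x‖) =
              q ^ m * (q ^ 2 + 2 * q) * ‖x‖ := by ring
          rw [this]
          positivity

/-- If `T² - ZT + q² = 0` with `Z` symmetric commuting with `T`, and the real eigenvalues of `T`
have modulus at most `q`, then the powers of `T` grow like `m q ^ m`. -/
theorem norm_pow_apply_le_of_central_quadratic [FiniteDimensional ℝ H] {Z T : Module.End ℝ H}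
    (hZ : Z.IsSymmetric) (hc : ∀ x, T (Z x) = Z (T x)) {q : ℝ} (hq : 0 < q)
    (hT : ∀ x, T (T x) = Z (T x) - q ^ 2 • x) (hb : ∀ x, ‖T x‖ ≤ q ^ 2 * ‖x‖)
    (heig : ∀ (β : ℝ) (x : H), x ≠ 0 → T x = β • x → |β| ≤ q) (m : ℕ) (x : H) :
    ‖(T ^ m) x‖ ≤ (q + 1) * (m + 1) * q ^ m * ‖x‖ := by
  have hcm : ∀ (m : ℕ) (x : H), (T ^ m) (Z x) = Z ((T ^ m) x) := by
    intro m
    induction m with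
    | zero => simp
    | succ m ih => intro x; rw [pow_succ, Module.End.mul_apply, hc, ih, Module.End.mul_apply]
  refine norm_apply_le_of_commute_symmetric hZ (hcm m) (by positivity) ?_ x
  intro z x hx
  have hTx : T (T x) = z • T x - q ^ 2 • x := by
    rw [hT, ← hc, hx, map_smul]
  rcases le_or_gt |z| (2 * q) with hz | hz
  · refine norm_pow_apply_le_of_quadratic hq hz (fun m => ?_) (hb x) m
    rw [pow_add, Module.End.mul_apply, pow_two, Module.End.mul_apply, hTx, map_sub, map_smul,
      map_smul, pow_succ T m, Module.End.mul_apply]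
  -- Now the roots are real with product q² and |α + β| > 2q, so one of them exceeds q in modulus.
  · obtain ⟨α, β, hαβ, hsum, hβ⟩ : ∃ α β : ℝ, α * β = q ^ 2 ∧ α + β = z ∧ q < |β| := by
      set d := √(z ^ 2 - 4 * q ^ 2) with hd
      have hd2 : d ^ 2 = z ^ 2 - 4 * q ^ 2 := by
        rw [hd, Real.sq_sqrt]
        nlinarith [sq_abs z, abs_nonneg z]
      by_cases h : q < |(z + d) / 2|
      · exact ⟨(z - d) / 2, (z + d) / 2, by nlinarith, by ring, h⟩
      · refine ⟨(z + d) / 2, (z - d) / 2, by nlinarith, by ring, ?_⟩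
        by_contra h'
        have := abs_add_le ((z + d) / 2) ((z - d) / 2)
        rw [show (z + d) / 2 + (z - d) / 2 = z by ring] at this
        linarith
    have hα : |α| ≤ q := by
      have h1 : |α| * |β| = q ^ 2 := by rw [← abs_mul, hαβ, abs_of_pos (by positivity)]
      by_contra! h
      nlinarith
    -- T x - αx is killed by T - β; if nonzero it would be an eigenvector with eigenvalue of modulus
    -- above q.
    have hy : T x = α • x := by
      by_contra hne
      have h0 : T x - α • x ≠ 0 := sub_ne_zero.2 hne
      refine absurd (heig β _ h0 ?_) hβ.not_ge
      rw [map_sub, map_smul, hTx, ← hsum, ← hαβ]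
      module
    have hpow : ∀ m : ℕ, (T ^ m) x = α ^ m • x := by
      intro m
      induction m with
      | zero => simp
      | succ m ih => rw [pow_succ, Module.End.mul_apply, hy, map_smul, ih, smul_smul, pow_succ']
    rw [hpow, norm_smul, norm_pow, Real.norm_eq_abs]
    have h1 : |α| ^ m ≤ q ^ m := pow_le_pow_left₀ (abs_nonneg _) hα m
    have h2 : (1 : ℝ) ≤ (q + 1) * (m + 1) := by nlinarith [Nat.cast_nonneg (α := ℝ) m]
    gcongr
    nlinarith [pow_pos hq m]

/-- A symmetric operator satisfying a Hecke relation with eigenvalues `c`, `-1` has norm `≤ c`. -/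
theorem norm_apply_le_of_hecke {a : Module.End ℝ H} (ha : a.IsSymmetric) {c : ℝ} (hc : 1 ≤ c)
    (h : ∀ x, a (a x) = (c - 1) • a x + c • x) (x : H) : ‖a x‖ ≤ c * ‖x‖ := by
  have h1 : ‖a x‖ ^ 2 = (c - 1) * inner ℝ (a x) x + c * ‖x‖ ^ 2 := by
    rw [← real_inner_self_eq_norm_sq, ← real_inner_self_eq_norm_sq, ← ha (a x) x, h,
      inner_add_left, inner_smul_left, inner_smul_left]
    simp
  have h2 := real_inner_le_norm (a x) x
  have h3 := norm_nonneg x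
  have h4 := norm_nonneg (a x)
  -- The identity `h1` and Cauchy–Schwarz give (‖a x‖ - c‖x‖)(‖a x‖ + ‖x‖) ≤ 0.
  by_contra! h5
  have h6 : 0 < ‖a x‖ + ‖x‖ := by
    have : 0 ≤ c * ‖x‖ := by positivity
    linarith
  have h7 := mul_le_mul_of_nonneg_left h2 (sub_nonneg.2 hc)
  nlinarith [mul_pos (sub_pos.2 h5) h6]

/-- Power bound for the product of two Hecke operators, in terms of the real eigenvalues of the
product. -/
theorem norm_pow_apply_le_of_hecke_pair [FiniteDimensional ℝ H] {a b : Module.End ℝ H}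
    (ha : a.IsSymmetric) (hb : b.IsSymmetric) {k K : ℝ} (hk : 1 ≤ k) (hK : 1 < K)
    (haa : ∀ x, a (a x) = (k - 1) • a x + k • x) (hbb : ∀ x, b (b x) = (K - 1) • b x + K • x)
    (hcommon : ∀ x, a x = k • x → b x = K • x → x = 0)
    (heig : ∀ (β : ℝ) (x : H), x ≠ 0 → a (b x) = β • x → β ≠ K * k → |β| ≤ √(K * k))
    (m : ℕ) (x : H) :
    ‖((a * b) ^ m) x‖ ≤ (√(K * k) + 1) * (m + 1) * √(K * k) ^ m * ‖x‖ := by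
  have hKk : 0 < K * k := by positivity
  have hsq : √(K * k) ^ 2 = K * k := Real.sq_sqrt hKk.le
  have hna := norm_apply_le_of_hecke ha hk haa
  have hnb := norm_apply_le_of_hecke hb hK.le hbb
  have hbound : ∀ x, ‖a (b x)‖ ≤ K * k * ‖x‖ := fun x => by
    calc _ ≤ k * ‖b x‖ := hna _
      _ ≤ k * (K * ‖x‖) := by gcongr; exact hnb x
      _ = _ := by ring
  -- This Z is T + Kk T⁻¹ for T = ab: the Hecke relations give k a⁻¹ = a - (k-1) and K b⁻¹ = b -
  -- (K-1), so Kk T⁻¹ = (b - (K-1))(a - (k-1)). It generates the centre of the generic Hecke algebra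
  -- of the infinite dihedral group.
  refine norm_pow_apply_le_of_central_quadratic
    (Z := a * b + b * a - (k - 1) • b - (K - 1) • a + ((K - 1) * (k - 1)) • 1)
    ?_ ?_ (Real.sqrt_pos.2 hKk) ?_ ?_ ?_ m x
  · intro x y
    simp only [LinearMap.add_apply, LinearMap.sub_apply, LinearMap.smul_apply,
      Module.End.mul_apply, Module.End.one_apply, inner_add_left, inner_sub_left, inner_smul_left,
      inner_add_right, inner_sub_right, inner_smul_right]
    rw [ha (b x) y, hb x (a y), hb (a x) y, ha x (b y), ha x y, hb x y]
    simp
    ring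
  · intro x
    simp only [LinearMap.add_apply, LinearMap.sub_apply, LinearMap.smul_apply,
      Module.End.mul_apply, Module.End.one_apply, map_add, map_sub, map_smul, haa, hbb]
    module
  · intro x
    simp only [LinearMap.add_apply, LinearMap.sub_apply, LinearMap.smul_apply,
      Module.End.mul_apply, Module.End.one_apply, map_add, map_smul, haa, hbb, hsq]
    module
  · intro x
    rw [hsq]
    exact hbound x
  -- The eigenvalue Kk must be excluded. Since ‖a‖ ≤ k and ‖b‖ ≤ K, it forces ‖b x‖ = K‖x‖, hence
  -- equality in Cauchy–Schwarz (this uses K > 1), b x = Kx and a x = kx.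
  · intro β x hx hβ
    refine heig β x hx hβ ?_
    rintro rfl
    apply hx
    have hx0 : 0 < ‖x‖ := norm_pos_iff.2 hx
    have hβ' : a (b x) = (K * k) • x := hβ
    have h1 : K * ‖x‖ ≤ ‖b x‖ := by
      have := hna (b x)
      rw [hβ', norm_smul, Real.norm_of_nonneg hKk.le] at this
      by_contra! h
      nlinarith
    have h2 : ‖b x‖ ^ 2 = (K - 1) * inner ℝ (b x) x + K * ‖x‖ ^ 2 := by
      rw [← real_inner_self_eq_norm_sq, ← real_inner_self_eq_norm_sq, ← hb (b x) x, hbb,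
        inner_add_left, inner_smul_left, inner_smul_left]
      simp
    have h3 : b x = K • x := by
      rw [← sub_eq_zero, ← norm_eq_zero, ← sq_eq_zero_iff, norm_sub_sq_real, inner_smul_right,
        norm_smul, Real.norm_of_nonneg (by linarith)]
      have h4 : ‖b x‖ = K * ‖x‖ := le_antisymm (hnb x) h1
      have h5 : inner ℝ (b x) x = K * ‖x‖ ^ 2 := by
        rw [h4] at h2
        have : (K - 1) * (inner ℝ (b x) x - K * ‖x‖ ^ 2) = 0 := by nlinarith
        rcases mul_eq_zero.1 this with h | h <;> linarith
      rw [h4, h5]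
      ring
    refine hcommon x ?_ h3
    rw [h3, map_smul, mul_smul] at hβ'
    exact smul_right_injective _ (by linarith : K ≠ 0) hβ'

/-- Norm bounds pass from the powers of `a b` to those of its adjoint `b a`. -/
theorem norm_pow_apply_le_of_symmetric_swap {a b : Module.End ℝ H}
    (ha : a.IsSymmetric) (hb : b.IsSymmetric) {m : ℕ} {c : ℝ} (hc : 0 ≤ c)
    (h : ∀ x, ‖((a * b) ^ m) x‖ ≤ c * ‖x‖) (x : H) : ‖((b * a) ^ m) x‖ ≤ c * ‖x‖ := by
  have hadj : ∀ (m : ℕ) (x y : H), inner ℝ (((b * a) ^ m) x) y = inner ℝ x (((a * b) ^ m) y) := by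
    intro m
    induction m with
    | zero => simp
    | succ m ih =>
      intro x y
      rw [pow_succ, Module.End.mul_apply, ih, Module.End.mul_apply, hb, ha, pow_succ',
        Module.End.mul_apply, Module.End.mul_apply]
  have h1 := hadj m x (((b * a) ^ m) x)
  rw [real_inner_self_eq_norm_sq] at h1
  have h2 := real_inner_le_norm x (((a * b) ^ m) (((b * a) ^ m) x))
  have h3 := h (((b * a) ^ m) x)
  have h4 := norm_nonneg x
  have h5 := norm_nonneg (((b * a) ^ m) x)
  by_contra! h6
  have h7 : 0 < ‖((b * a) ^ m) x‖ := lt_of_le_of_lt (by positivity) h6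
  nlinarith [mul_le_mul_of_nonneg_left h3 h4]

end PowerBounds

/-! ### From operators on sum-zero functions to ℓ¹ bounds for matrices. -/

section MatrixPowerBounds

open Matrix

variable {ι : Type*} [Fintype ι]

theorem sum_mulVec_of_isSymm {a : Matrix ι ι ℝ} (ha : a.IsSymm) {k : ℝ}
    (ha1 : a *ᵥ 1 = k • 1) (f : ι → ℝ) : ∑ i, (a *ᵥ f) i = k * ∑ i, f i := by
  have h : (1 : ι → ℝ) ⬝ᵥ (a *ᵥ f) = (k • (1 : ι → ℝ)) ⬝ᵥ f := by
    rw [dotProduct_mulVec, ← mulVec_transpose, ha.eq, ha1]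
  simpa [dotProduct, Finset.mul_sum] using h

variable [DecidableEq ι]

/-- `ℓ²` bound for the powers of a product of two Hecke matrices on sum-zero functions. -/
theorem norm_pow_mulVec_le_of_hecke_pair {a b : Matrix ι ι ℝ} (ha : a.IsSymm) (hb : b.IsSymm)
    {k K : ℝ} (hk : 1 ≤ k) (hK : 1 < K) (haa : a * a = (k - 1) • a + k • 1)
    (hbb : b * b = (K - 1) • b + K • 1) (ha1 : a *ᵥ 1 = k • 1) (hb1 : b *ᵥ 1 = K • 1)
    (hcommon : ∀ f : ι → ℝ, ∑ i, f i = 0 → a *ᵥ f = k • f → b *ᵥ f = K • f → f = 0)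
    (heig : ∀ (β : ℝ) (f : ι → ℝ), f ≠ 0 → a *ᵥ (b *ᵥ f) = β • f → β ≠ K * k → |β| ≤ √(K * k))
    (m : ℕ) (f : ι → ℝ) (hf : ∑ i, f i = 0) :
    ‖WithLp.toLp 2 ((a * b) ^ m *ᵥ f)‖ ≤
        (√(K * k) + 1) * (m + 1) * √(K * k) ^ m * ‖WithLp.toLp 2 f‖ ∧
      ‖WithLp.toLp 2 ((b * a) ^ m *ᵥ f)‖ ≤
        (√(K * k) + 1) * (m + 1) * √(K * k) ^ m * ‖WithLp.toLp 2 f‖ := by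
  -- The orthogonal complement of the constants. It is stable because the matrices are symmetric and
  -- the constants are eigenvectors.
  let S : Submodule ℝ (EuclideanSpace ℝ ι) :=
    { carrier := {x | ∑ i, x i = 0}
      add_mem' := fun {x y} hx hy => by
        simp only [Set.mem_ofPred_eq, PiLp.add_apply, Finset.sum_add_distrib] at *
        rw [hx, hy, add_zero]
      zero_mem' := by simp
      smul_mem' := fun c x hx => by
        simp only [Set.mem_ofPred_eq, PiLp.smul_apply, smul_eq_mul, ← Finset.mul_sum] at *
        rw [hx, mul_zero] }
  have hmem : ∀ x : EuclideanSpace ℝ ι, x ∈ S ↔ ∑ i, x i = 0 := fun x => Iff.rfl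
  have hSa : ∀ x ∈ S, toEuclideanLin a x ∈ S := fun x hx => by
    rw [hmem] at *
    rw [toLpLin_apply]
    simp only
    rw [sum_mulVec_of_isSymm ha ha1, hx, mul_zero]
  have hSb : ∀ x ∈ S, toEuclideanLin b x ∈ S := fun x hx => by
    rw [hmem] at *
    rw [toLpLin_apply]
    simp only
    rw [sum_mulVec_of_isSymm hb hb1, hx, mul_zero]
  let A : Module.End ℝ S := (toEuclideanLin a).restrict hSa
  let B : Module.End ℝ S := (toEuclideanLin b).restrict hSb
  have hA : ∀ x : S, ((A x : S) : EuclideanSpace ℝ ι) = WithLp.toLp 2 (a *ᵥ x.1.ofLp) :=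
    fun x => rfl
  have hB : ∀ x : S, ((B x : S) : EuclideanSpace ℝ ι) = WithLp.toLp 2 (b *ᵥ x.1.ofLp) :=
    fun x => rfl
  have hAs : A.IsSymmetric := LinearMap.IsSymmetric.restrict_invariant
    (isSymmetric_toEuclideanLin_iff.2
      (by rw [IsHermitian, conjTranspose_eq_transpose_of_trivial, ha.eq])) hSa
  have hBs : B.IsSymmetric := LinearMap.IsSymmetric.restrict_invariant
    (isSymmetric_toEuclideanLin_iff.2
      (by rw [IsHermitian, conjTranspose_eq_transpose_of_trivial, hb.eq])) hSb
  have hAA : ∀ x, A (A x) = (k - 1) • A x + k • x := fun x => by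
    apply Subtype.ext
    rw [hA, hA]
    simp only [Submodule.coe_add, Submodule.coe_smul, hA, mulVec_mulVec, haa, add_mulVec,
      smul_mulVec, one_mulVec]
    rfl
  have hBB : ∀ x, B (B x) = (K - 1) • B x + K • x := fun x => by
    apply Subtype.ext
    rw [hB, hB]
    simp only [Submodule.coe_add, Submodule.coe_smul, hB, mulVec_mulVec, hbb, add_mulVec,
      smul_mulVec, one_mulVec]
    rfl
  have hne : ∀ x : S, x ≠ 0 → x.1.ofLp ≠ 0 := fun x hx h => hx <| by
    apply Subtype.ext
    exact (WithLp.ofLp_eq_zero 2).1 h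
  have hbnd := norm_pow_apply_le_of_hecke_pair hAs hBs hk hK hAA hBB
    (fun x h1 h2 => by
      by_contra hx
      refine hne x hx (hcommon _ x.2 ?_ ?_)
      · simpa [hA] using congrArg (fun y : S => y.1.ofLp) h1
      · simpa [hB] using congrArg (fun y : S => y.1.ofLp) h2)
    (fun β x hx h hβ => by
      refine heig β _ (hne x hx) ?_ hβ
      have := congrArg (fun y : S => y.1.ofLp) h
      simpa [hA, hB] using this) m
  have hbnd' := norm_pow_apply_le_of_symmetric_swap hAs hBs (by positivity) hbnd
  have hpow : ∀ (m : ℕ) (x : S), (((A * B) ^ m) x : EuclideanSpace ℝ ι) =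
      WithLp.toLp 2 ((a * b) ^ m *ᵥ x.1.ofLp) := by
    intro m
    induction m with
    | zero => simp
    | succ m ih =>
      intro x
      rw [pow_succ, Module.End.mul_apply, ih, Module.End.mul_apply, hA, hB, pow_succ]
      simp [mulVec_mulVec]
  have hpow' : ∀ (m : ℕ) (x : S), (((B * A) ^ m) x : EuclideanSpace ℝ ι) =
      WithLp.toLp 2 ((b * a) ^ m *ᵥ x.1.ofLp) := by
    intro m
    induction m with
    | zero => simp
    | succ m ih =>
      intro x
      rw [pow_succ, Module.End.mul_apply, ih, Module.End.mul_apply, hB, hA, pow_succ]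
      simp [mulVec_mulVec]
  have hfS : WithLp.toLp 2 f ∈ S := hf
  have h1 := hbnd ⟨_, hfS⟩
  have h2 := hbnd' ⟨_, hfS⟩
  rw [Submodule.coe_norm, Submodule.coe_norm, hpow] at h1
  rw [Submodule.coe_norm, Submodule.coe_norm, hpow'] at h2
  exact ⟨h1, h2⟩

/-- If a matrix `M` with constant row sums and its transpose satisfies an `ℓ²` bound on sum-zero
functions, then the rows of `Mᵀ / c` are close to uniform in `ℓ¹`. -/
theorem sum_abs_transpose_row_sub_le {M : Matrix ι ι ℝ} {c d : ℝ} (hc : 0 < c) (hd : 0 ≤ d)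
    (h1 : M *ᵥ 1 = c • 1)
    (hM : ∀ f : ι → ℝ, ∑ i, f i = 0 →
      ‖WithLp.toLp 2 (M *ᵥ f)‖ ≤ d * ‖WithLp.toLp 2 f‖) (i : ι) :
    ∑ j, |c⁻¹ * M j i - (Fintype.card ι : ℝ)⁻¹| ≤ √(Fintype.card ι) * (d / c) := by
  have : Nonempty ι := ⟨i⟩
  set N : ℝ := (Fintype.card ι : ℝ) with hN
  have hN0 : 0 < N := by rw [hN]; exact_mod_cast Fintype.card_pos
  -- M f is column i of M minus its mean c/N. As f has norm at most 1, the bound for M applies, and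
  -- passing from ℓ² to ℓ¹ costs √N.
  set f : ι → ℝ := Pi.single i 1 - N⁻¹ • 1 with hf
  have hf0 : ∑ j, f j = 0 := by
    simp [hf, Finset.sum_sub_distrib, ← hN, hN0.ne']
  have hfn : ‖WithLp.toLp 2 f‖ ≤ 1 := by
    rw [EuclideanSpace.norm_eq, Real.sqrt_le_one]
    -- f is orthogonal to the constants, so ‖f‖² = ⟨f, δ_i⟩ = 1 - 1/N.
    have : ∑ j, ‖f j‖ ^ 2 = ∑ j, f j * (Pi.single i 1 : ι → ℝ) j := by
      have h0 : ∑ j, f j * N⁻¹ = 0 := by rw [← Finset.sum_mul, hf0, zero_mul]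
      rw [← sub_eq_zero, ← neg_eq_zero, ← h0, neg_sub, ← Finset.sum_sub_distrib]
      refine Finset.sum_congr rfl fun j _ => ?_
      rw [Real.norm_eq_abs, sq_abs]
      simp only [hf, Pi.sub_apply, Pi.smul_apply, Pi.one_apply, smul_eq_mul]
      ring
    simp only [this]
    simp [Pi.single_apply, hf]
    positivity
  have hMf : ∀ j, (M *ᵥ f) j = c * (c⁻¹ * M j i - N⁻¹) := fun j => by
    rw [hf, mulVec_sub, mulVec_smul, h1]
    simp
    field_simp
  have h2 := (hM f hf0).trans (mul_le_mul_of_nonneg_left hfn hd)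
  rw [mul_one] at h2
  have h3 : ∑ j, |(M *ᵥ f) j| ≤ √N * ‖WithLp.toLp 2 (M *ᵥ f)‖ := by
    rw [EuclideanSpace.norm_eq, ← Real.sqrt_mul hN0.le]
    apply Real.le_sqrt_of_sq_le
    have := sq_sum_le_card_mul_sum_sq (s := Finset.univ) (f := fun j => |(M *ᵥ f) j|)
    simpa [hN] using this
  have h4 : ∑ j, |(M *ᵥ f) j| = c * ∑ j, |c⁻¹ * M j i - N⁻¹| := by
    rw [Finset.mul_sum]
    refine Finset.sum_congr rfl fun j _ => ?_
    rw [hMf, abs_mul, abs_of_pos hc]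
  rw [← mul_div_assoc, le_div_iff₀ hc, mul_comm, ← h4]
  exact h3.trans (mul_le_mul_of_nonneg_left h2 (Real.sqrt_nonneg _))

end MatrixPowerBounds

/-! ### The non-backtracking operator as a Hecke pair on edges. -/

namespace Bigraph

open Matrix

variable {K k : ℕ} (X : Bigraph.{u} K k)

/-- The unoriented edges of a bigraph, as pairs (left end, right end). -/
abbrev Edge : Type u := {p : X.L × X.R // X.graph.Adj (Sum.inl p.1) (Sum.inr p.2)}

theorem not_adj_inl (l l' : X.L) : ¬ X.graph.Adj (Sum.inl l) (Sum.inl l') := fun h => by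
  simpa using X.bipartite h

theorem not_adj_inr (r r' : X.R) : ¬ X.graph.Adj (Sum.inr r) (Sum.inr r') := fun h => by
  simpa using X.bipartite h

/-- Directed edges are edges with one of the two orientations. -/
def toDart : X.Edge ⊕ X.Edge → X.graph.Dart
  | Sum.inl p => ⟨(Sum.inl p.1.1, Sum.inr p.1.2), p.2⟩
  | Sum.inr p => ⟨(Sum.inr p.1.2, Sum.inl p.1.1), p.2.symm⟩

theorem toDart_bijective : Function.Bijective X.toDart := by
  constructor
  · rintro (p | p) (p' | p') h <;>
      simp only [toDart, SimpleGraph.Dart.mk.injEq, Prod.mk.injEq, Sum.inl.injEq, Sum.inr.injEq,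
        reduceCtorEq, and_self] at h
    · exact congrArg Sum.inl (Subtype.ext (Prod.ext h.1 h.2))
    · exact congrArg Sum.inr (Subtype.ext (Prod.ext h.2 h.1))
  · rintro ⟨⟨l | r, l' | r'⟩, h⟩
    · exact absurd h (X.not_adj_inl _ _)
    · exact ⟨Sum.inl ⟨(l, r'), h⟩, rfl⟩
    · exact ⟨Sum.inr ⟨(l', r), h.symm⟩, rfl⟩
    · exact absurd h (X.not_adj_inr _ _)

/-- Directed edges are edges with one of the two orientations. -/
noncomputable def dartEquiv : X.Edge ⊕ X.Edge ≃ X.graph.Dart :=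
  Equiv.ofBijective X.toDart X.toDart_bijective

@[simp] theorem dartEquiv_inl_fst (p : X.Edge) : (X.dartEquiv (Sum.inl p)).fst = Sum.inl p.1.1 :=
  rfl

@[simp] theorem dartEquiv_inl_snd (p : X.Edge) : (X.dartEquiv (Sum.inl p)).snd = Sum.inr p.1.2 :=
  rfl

@[simp] theorem dartEquiv_inr_fst (p : X.Edge) : (X.dartEquiv (Sum.inr p)).fst = Sum.inr p.1.2 :=
  rfl

@[simp] theorem dartEquiv_inr_snd (p : X.Edge) : (X.dartEquiv (Sum.inr p)).snd = Sum.inl p.1.1 :=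
  rfl

/-- Adjacency of distinct edges sharing their right end. -/
def rightMatrix (S : Type*) [Zero S] [One S] : Matrix X.Edge X.Edge S :=
  Matrix.of fun p p' => if p.1.2 = p'.1.2 ∧ p'.1.1 ≠ p.1.1 then 1 else 0

/-- Adjacency of distinct edges sharing their left end. -/
def leftMatrix (S : Type*) [Zero S] [One S] : Matrix X.Edge X.Edge S :=
  Matrix.of fun p p' => if p.1.1 = p'.1.1 ∧ p'.1.2 ≠ p.1.2 then 1 else 0

theorem nbMatrix_submatrix :
    (nbMatrix X.graph).submatrix X.dartEquiv X.dartEquiv =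
      fromBlocks 0 (X.rightMatrix ℂ) (X.leftMatrix ℂ) 0 := by
  ext (p | p) (p' | p') <;> simp [nbMatrix, rightMatrix, leftMatrix]

theorem nbrwMatrix_submatrix :
    (nbrwMatrix X.graph).submatrix X.dartEquiv X.dartEquiv =
      fromBlocks 0 ((k : ℝ)⁻¹ • X.rightMatrix ℝ) ((K : ℝ)⁻¹ • X.leftMatrix ℝ) 0 := by
  have hr : ∀ p : X.Edge, X.graph.degree (X.dartEquiv (Sum.inl p)).snd = k + 1 :=
    fun p => X.degree_right _
  have hl : ∀ p : X.Edge, X.graph.degree (X.dartEquiv (Sum.inr p)).snd = K + 1 :=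
    fun p => X.degree_left _
  ext (p | p) (p' | p')
  · simp [nbrwMatrix]
  · simp only [nbrwMatrix, submatrix_apply, of_apply, hr]
    simp [rightMatrix]
  · simp only [nbrwMatrix, submatrix_apply, of_apply, hl]
    simp [leftMatrix]
  · simp [nbrwMatrix]

theorem card_filter_right (r : X.R) :
    (Finset.univ.filter fun p : X.Edge => p.1.2 = r).card = k + 1 := by
  rw [← X.degree_right r, ← SimpleGraph.card_neighborFinset_eq_degree]
  refine Finset.card_bij (fun p _ => Sum.inl p.1.1) ?_ ?_ ?_
  · intro p hp
    rw [Finset.mem_filter] at hp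
    rw [SimpleGraph.mem_neighborFinset, ← hp.2]
    exact p.2.symm
  · intro p hp p' hp' h
    rw [Finset.mem_filter] at hp hp'
    exact Subtype.ext (Prod.ext (Sum.inl_injective h) (hp.2.trans hp'.2.symm))
  · rintro (l | r') h
    · rw [SimpleGraph.mem_neighborFinset] at h
      exact ⟨⟨(l, r), h.symm⟩, by simp, rfl⟩
    · rw [SimpleGraph.mem_neighborFinset] at h
      exact absurd h (X.not_adj_inr _ _)

theorem card_filter_left (l : X.L) :
    (Finset.univ.filter fun p : X.Edge => p.1.1 = l).card = K + 1 := by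
  rw [← X.degree_left l, ← SimpleGraph.card_neighborFinset_eq_degree]
  refine Finset.card_bij (fun p _ => Sum.inr p.1.2) ?_ ?_ ?_
  · intro p hp
    rw [Finset.mem_filter] at hp
    rw [SimpleGraph.mem_neighborFinset, ← hp.2]
    exact p.2
  · intro p hp p' hp' h
    rw [Finset.mem_filter] at hp hp'
    exact Subtype.ext (Prod.ext (hp.2.trans hp'.2.symm) (Sum.inr_injective h))
  · rintro (l' | r) h
    · rw [SimpleGraph.mem_neighborFinset] at h
      exact absurd h (X.not_adj_inl _ _)
    · rw [SimpleGraph.mem_neighborFinset] at h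
      exact ⟨⟨(l, r), h⟩, by simp, rfl⟩

/-- The matrix of the relation "same image under `g`". -/
theorem _root_.Matrix.sameFiber_mul_self {ι β : Type*} [Fintype ι] [DecidableEq β] (g : ι → β)
    {c : ℕ} (hc : ∀ i, (Finset.univ.filter fun j => g j = g i).card = c) :
    (Matrix.of fun i j => if g i = g j then (1 : ℝ) else 0) *
      (Matrix.of fun i j => if g i = g j then (1 : ℝ) else 0) =
      (c : ℝ) • Matrix.of fun i j => if g i = g j then (1 : ℝ) else 0 := by
  ext i j
  simp only [mul_apply, of_apply, Matrix.smul_apply, smul_eq_mul, mul_ite, mul_one, mul_zero]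
  by_cases h : g i = g j
  · rw [if_pos h, ← hc i, Finset.card_filter]
    push_cast
    refine Finset.sum_congr rfl fun x _ => ?_
    by_cases hx : g x = g i
    · rw [if_pos (hx.trans h), if_pos hx.symm, if_pos hx]
    · rw [if_neg hx, if_neg (fun h' => hx (h'.trans h.symm))]
  · rw [if_neg h]
    refine Finset.sum_eq_zero fun x _ => ?_
    by_cases hx : g x = g j
    · rw [if_pos hx, if_neg (fun h' => h (h'.trans hx))]
    · rw [if_neg hx]

theorem rightMatrix_eq :
    X.rightMatrix ℝ = (Matrix.of fun p p' : X.Edge => if p.1.2 = p'.1.2 then (1 : ℝ) else 0) -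
      1 := by
  ext p p'
  simp only [rightMatrix, of_apply, Matrix.sub_apply, one_apply]
  by_cases h : p = p'
  · simp [h]
  · by_cases h2 : p.1.2 = p'.1.2
    · have : p'.1.1 ≠ p.1.1 := fun h1 => h (Subtype.ext (Prod.ext h1.symm h2))
      simp [h, h2, this]
    · simp [h, h2]

theorem leftMatrix_eq :
    X.leftMatrix ℝ = (Matrix.of fun p p' : X.Edge => if p.1.1 = p'.1.1 then (1 : ℝ) else 0) -
      1 := by
  ext p p'
  simp only [leftMatrix, of_apply, Matrix.sub_apply, one_apply]
  by_cases h : p = p'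
  · simp [h]
  · by_cases h2 : p.1.1 = p'.1.1
    · have : p'.1.2 ≠ p.1.2 := fun h1 => h (Subtype.ext (Prod.ext h2 h1.symm))
      simp [h, h2, this]
    · simp [h, h2]

/-- The matrix is J - 1, where J relates edges with the same right end and J² = (k+1)J because the
classes have k + 1 elements. -/
theorem rightMatrix_mul_self :
    X.rightMatrix ℝ * X.rightMatrix ℝ = ((k : ℝ) - 1) • X.rightMatrix ℝ + (k : ℝ) • 1 := by
  have h := Matrix.sameFiber_mul_self (fun p : X.Edge => p.1.2)
    (fun p => X.card_filter_right p.1.2)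
  rw [rightMatrix_eq, sub_mul, mul_sub, h]
  push_cast
  simp only [mul_one, one_mul]
  module

theorem leftMatrix_mul_self :
    X.leftMatrix ℝ * X.leftMatrix ℝ = ((K : ℝ) - 1) • X.leftMatrix ℝ + (K : ℝ) • 1 := by
  have h := Matrix.sameFiber_mul_self (fun p : X.Edge => p.1.1)
    (fun p => X.card_filter_left p.1.1)
  rw [leftMatrix_eq, sub_mul, mul_sub, h]
  push_cast
  simp only [mul_one, one_mul]
  module

theorem rightMatrix_mulVec (f : X.Edge → ℝ) (p : X.Edge) :
    (X.rightMatrix ℝ *ᵥ f) p = ∑ p' ∈ Finset.univ.filter (fun p' : X.Edge => p'.1.2 = p.1.2), f p'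
      - f p := by
  rw [rightMatrix_eq, sub_mulVec, one_mulVec, Pi.sub_apply, Finset.sum_filter]
  congr 1
  simp [mulVec, dotProduct, eq_comm]

theorem leftMatrix_mulVec (f : X.Edge → ℝ) (p : X.Edge) :
    (X.leftMatrix ℝ *ᵥ f) p = ∑ p' ∈ Finset.univ.filter (fun p' : X.Edge => p'.1.1 = p.1.1), f p'
      - f p := by
  rw [leftMatrix_eq, sub_mulVec, one_mulVec, Pi.sub_apply, Finset.sum_filter]
  congr 1
  simp [mulVec, dotProduct, eq_comm]

theorem rightMatrix_mulVec_one : X.rightMatrix ℝ *ᵥ 1 = (k : ℝ) • 1 := by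
  ext p
  rw [rightMatrix_mulVec]
  simp [X.card_filter_right]

theorem leftMatrix_mulVec_one : X.leftMatrix ℝ *ᵥ 1 = (K : ℝ) • 1 := by
  ext p
  rw [leftMatrix_mulVec]
  simp [X.card_filter_left]

theorem rightMatrix_isSymm : (X.rightMatrix ℝ).IsSymm := by
  ext p p'
  simp [rightMatrix, eq_comm]

theorem leftMatrix_isSymm : (X.leftMatrix ℝ).IsSymm := by
  ext p p'
  simp [leftMatrix, eq_comm]

/-- A function on edges constant around each vertex is constant. -/
theorem eq_of_forall_incident {f : X.Edge → ℝ} (hl : ∀ p p' : X.Edge, p.1.1 = p'.1.1 → f p = f p')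
    (hr : ∀ p p' : X.Edge, p.1.2 = p'.1.2 → f p = f p') (p p' : X.Edge) : f p = f p' := by
  have key : ∀ v w : X.L ⊕ X.R, X.graph.Walk v w → ∀ p p' : X.Edge,
      (v = Sum.inl p.1.1 ∨ v = Sum.inr p.1.2) → (w = Sum.inl p'.1.1 ∨ w = Sum.inr p'.1.2) →
      f p = f p' := by
    intro v w W
    induction W with
    | nil =>
      rintro p p' (rfl | rfl) (h | h)
      · exact hl _ _ (Sum.inl_injective h)
      · simp at h
      · simp at h
      · exact hr _ _ (Sum.inr_injective h)
    | cons hadj _ ih =>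
      rename_i a b c _
      intro p p' hp hp'
      rcases hp with rfl | rfl
      · rcases b with l | r
        · exact absurd hadj (X.not_adj_inl _ _)
        · exact (hl p ⟨(p.1.1, r), hadj⟩ rfl).trans (ih _ _ (Or.inr rfl) hp')
      · rcases b with l | r
        · exact (hr p ⟨(l, p.1.2), hadj.symm⟩ rfl).trans (ih _ _ (Or.inl rfl) hp')
        · exact absurd hadj (X.not_adj_inr _ _)
  obtain ⟨W⟩ := X.connected.preconnected (Sum.inl p.1.1) (Sum.inl p'.1.1)
  exact key _ _ W p p' (Or.inl rfl) (Or.inl rfl)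

/-- Adding f p to both sides of each eigenvalue equation shows that f p is the mean of f around each
end of p. So f is constant around every vertex, hence constant by connectedness, and its sum is
zero. -/
theorem eq_zero_of_common_eigenvector {f : X.Edge → ℝ} (h0 : ∑ p, f p = 0)
    (hr : X.rightMatrix ℝ *ᵥ f = (k : ℝ) • f) (hl : X.leftMatrix ℝ *ᵥ f = (K : ℝ) • f) :
    f = 0 := by
  have hc : ∀ p p', f p = f p' := by
    apply X.eq_of_forall_incident
    · intro p p' h
      have h1 := congrFun hl p
      have h2 := congrFun hl p'
      rw [leftMatrix_mulVec] at h1 h2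
      rw [← h] at h2
      simp only [Pi.smul_apply, smul_eq_mul] at h1 h2
      have h3 : ((K : ℝ) + 1) * f p = (K + 1) * f p' := by linarith
      exact mul_left_cancel₀ (by positivity) h3
    · intro p p' h
      have h1 := congrFun hr p
      have h2 := congrFun hr p'
      rw [rightMatrix_mulVec] at h1 h2
      rw [← h] at h2
      simp only [Pi.smul_apply, smul_eq_mul] at h1 h2
      have h3 : ((k : ℝ) + 1) * f p = (k + 1) * f p' := by linarith
      exact mul_left_cancel₀ (by positivity) h3
  ext p
  have : Nonempty X.Edge := ⟨p⟩
  have h1 : ∑ p', f p' = Fintype.card X.Edge * f p := by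
    rw [Finset.sum_congr rfl fun p' _ => hc p' p]
    simp
  rw [h0, eq_comm, mul_eq_zero] at h1
  simpa using h1

/-- A square root of an eigenvalue of the two-step operator is in the non-backtracking spectrum. -/
theorem mem_spectrum_nbMatrix {f : X.Edge → ℝ} (hf : f ≠ 0) {β : ℝ} (hβ : β ≠ 0)
    (h : X.rightMatrix ℝ *ᵥ (X.leftMatrix ℝ *ᵥ f) = β • f) {μ : ℂ} (hμ : μ ^ 2 = β) :
    μ ∈ spectrum ℂ (nbMatrix X.graph) := by
  have hμ0 : μ ≠ 0 := by
    rintro rfl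
    exact hβ (by simpa using hμ.symm)
  have e1 : spectrum ℂ (nbMatrix X.graph) =
      spectrum ℂ (fromBlocks 0 (X.rightMatrix ℂ) (X.leftMatrix ℂ) 0) := by
    rw [← AlgEquiv.spectrum_eq (Matrix.reindexAlgEquiv ℂ ℂ X.dartEquiv.symm),
      coe_reindexAlgEquiv, reindex_apply, Equiv.symm_symm, nbMatrix_submatrix]
  have hcast : ∀ (M : Matrix X.Edge X.Edge ℝ) (g : X.Edge → ℝ),
      (M.map Complex.ofReal) *ᵥ (fun p => (g p : ℂ)) = fun p => (((M *ᵥ g) p : ℝ) : ℂ) :=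
    fun M g => by
      ext p
      simp [mulVec, dotProduct]
  have hr : X.rightMatrix ℂ = (X.rightMatrix ℝ).map Complex.ofReal := by
    ext p p'
    simp [rightMatrix, apply_ite Complex.ofReal]
  have hl : X.leftMatrix ℂ = (X.leftMatrix ℝ).map Complex.ofReal := by
    ext p p'
    simp [leftMatrix, apply_ite Complex.ofReal]
  rw [e1, ← spectrum_toLin', ← Module.End.hasEigenvalue_iff_mem_spectrum]
  refine Module.End.hasEigenvalue_of_hasEigenvector
    (x := Sum.elim (fun p => (f p : ℂ)) (fun p => μ⁻¹ * ((X.leftMatrix ℝ *ᵥ f) p : ℂ))) ⟨?_, ?_⟩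
  · rw [Module.End.mem_eigenspace_iff, toLin'_apply, fromBlocks_mulVec]
    have h2 : (fun p => μ⁻¹ * ((X.leftMatrix ℝ *ᵥ f) p : ℂ)) =
        μ⁻¹ • fun p => ((X.leftMatrix ℝ *ᵥ f) p : ℂ) := rfl
    simp only [Sum.elim_comp_inl, Sum.elim_comp_inr, zero_mulVec, zero_add, add_zero]
    rw [h2, mulVec_smul, hr, hl, hcast, hcast, h]
    ext (p | p)
    · simp only [Sum.elim_inl, Pi.smul_apply, smul_eq_mul]
      push_cast
      rw [← hμ]
      field_simp
    · simp only [Sum.elim_inr, Pi.smul_apply, smul_eq_mul]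
      field_simp
  · intro h0
    apply hf
    ext p
    have := congrFun h0 (Sum.inl p)
    simpa using this

/-- A square root μ of β is a nontrivial eigenvalue of the non-backtracking operator when β ≠ 0, and
|β| = |μ|². On the circle this is √(Kk); the exceptional points give k or 1, both at most √(Kk)
because 1 ≤ k < K. -/
theorem abs_le_of_isRamanujan (hX : X.IsRamanujan) (hk : 1 ≤ k) (hkK : k < K) {f : X.Edge → ℝ}
    (hf : f ≠ 0) {β : ℝ} (h : X.rightMatrix ℝ *ᵥ (X.leftMatrix ℝ *ᵥ f) = β • f)
    (hβ : β ≠ K * k) : |β| ≤ √((K : ℝ) * k) := by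
  have hk' : (1 : ℝ) ≤ k := by exact_mod_cast hk
  have hkK' : (k : ℝ) ≤ K := by exact_mod_cast hkK.le
  have hle : (k : ℝ) ≤ √((K : ℝ) * k) := Real.le_sqrt_of_sq_le (by nlinarith)
  rcases eq_or_ne β 0 with rfl | hβ0
  · rw [abs_zero]
    positivity
  obtain ⟨μ, hμ⟩ : ∃ μ : ℂ, μ ^ 2 = β := IsAlgClosed.exists_pow_nat_eq _ (by norm_num)
  have hmem := X.mem_spectrum_nbMatrix hf hβ0 h hμ
  have habs : ‖μ‖ ^ 2 = |β| := by rw [← norm_pow, hμ, Complex.norm_real, Real.norm_eq_abs]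
  have hsq : (((√((K : ℝ) * k) : ℝ) : ℂ)) ^ 2 = ((K * k : ℝ) : ℂ) := by
    rw [← Complex.ofReal_pow, Real.sq_sqrt (by positivity)]
  have hne : μ ∉ ({((√(K * k) : ℝ) : ℂ), -((√(K * k) : ℝ) : ℂ)} : Set ℂ) := by
    rintro (rfl | h1)
    · rw [hsq] at hμ
      exact hβ (Complex.ofReal_injective hμ.symm)
    · rw [Set.mem_singleton_iff] at h1
      rw [h1, neg_sq, hsq] at hμ
      exact hβ (Complex.ofReal_injective hμ.symm)
  rcases hX ⟨hmem, hne⟩ with h1 | h1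
  · have h1' : ‖μ‖ = ((K : ℝ) * k) ^ (1 / 4 : ℝ) := h1
    rw [← habs, h1', ← Real.rpow_natCast, ← Real.rpow_mul (by positivity), Real.sqrt_eq_rpow]
    norm_num
  · have hk2 : ‖Complex.I * ((√k : ℝ) : ℂ)‖ ^ 2 = k := by
      simp
    simp only [Set.mem_insert_iff, Set.mem_singleton_iff] at h1
    rcases h1 with rfl | rfl | rfl | rfl
    · rw [← habs, hk2]; exact hle
    · rw [← habs, norm_neg, hk2]; exact hle
    · rw [← habs, norm_one, one_pow]; exact hk'.trans hle
    · rw [← habs, norm_neg, norm_one, one_pow]; exact hk'.trans hle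

theorem sum_abs_row_sub_le (hX : X.IsRamanujan) (hk : 1 ≤ k) (hkK : k < K) (m : ℕ) (p : X.Edge) :
    ∑ p', |((K : ℝ) * k)⁻¹ ^ m * ((X.rightMatrix ℝ * X.leftMatrix ℝ) ^ m) p p' -
        (Fintype.card X.Edge : ℝ)⁻¹| ≤
      √(Fintype.card X.Edge) * ((√(K * k) + 1) * (m + 1) * (√(K * k))⁻¹ ^ m) ∧
    ∑ p', |((K : ℝ) * k)⁻¹ ^ m * ((X.leftMatrix ℝ * X.rightMatrix ℝ) ^ m) p p' -
        (Fintype.card X.Edge : ℝ)⁻¹| ≤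
      √(Fintype.card X.Edge) * ((√(K * k) + 1) * (m + 1) * (√(K * k))⁻¹ ^ m) := by
  have hk' : (1 : ℝ) ≤ k := by exact_mod_cast hk
  have hK' : (1 : ℝ) < K := by exact_mod_cast hk.trans_lt hkK
  have hKk : 0 < (K : ℝ) * k := by positivity
  have hq : 0 < √((K : ℝ) * k) := Real.sqrt_pos.2 hKk
  have hbound := norm_pow_mulVec_le_of_hecke_pair X.rightMatrix_isSymm X.leftMatrix_isSymm hk' hK'
    X.rightMatrix_mul_self X.leftMatrix_mul_self X.rightMatrix_mulVec_one X.leftMatrix_mulVec_one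
    (fun f => X.eq_zero_of_common_eigenvector)
    (fun β f hf h hβ => X.abs_le_of_isRamanujan hX hk hkK hf h hβ) m
  have hpow1 : ∀ m : ℕ, ((X.rightMatrix ℝ * X.leftMatrix ℝ) ^ m) *ᵥ 1 = ((K : ℝ) * k) ^ m • 1 := by
    intro m
    induction m with
    | zero => simp
    | succ m ih =>
      rw [pow_succ, ← mulVec_mulVec, ← mulVec_mulVec, leftMatrix_mulVec_one, mulVec_smul,
        rightMatrix_mulVec_one, mulVec_smul, mulVec_smul, ih, smul_smul, smul_smul, pow_succ]
      congr 1
      ring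
  have hpow2 : ∀ m : ℕ, ((X.leftMatrix ℝ * X.rightMatrix ℝ) ^ m) *ᵥ 1 = ((K : ℝ) * k) ^ m • 1 := by
    intro m
    induction m with
    | zero => simp
    | succ m ih =>
      rw [pow_succ, ← mulVec_mulVec, ← mulVec_mulVec, rightMatrix_mulVec_one, mulVec_smul,
        leftMatrix_mulVec_one, mulVec_smul, mulVec_smul, ih, smul_smul, smul_smul, pow_succ]
      congr 1
      ring
  have ht : ∀ m : ℕ, ((X.leftMatrix ℝ * X.rightMatrix ℝ) ^ m)ᵀ =
      (X.rightMatrix ℝ * X.leftMatrix ℝ) ^ m := fun m => by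
    rw [transpose_pow, transpose_mul, X.leftMatrix_isSymm.eq, X.rightMatrix_isSymm.eq]
  have hconst : (√((K : ℝ) * k) + 1) * (m + 1) * √(K * k) ^ m / (K * k) ^ m =
      (√(K * k) + 1) * (m + 1) * (√(K * k))⁻¹ ^ m := by
    rw [inv_pow, mul_div_assoc, ← div_pow]
    congr 1
    rw [← inv_pow]
    congr 1
    nth_rewrite 2 [← Real.mul_self_sqrt hKk.le]
    field_simp
  constructor
  -- The ℓ¹ estimate concerns columns, so rows of (ab)^m are handled through its transpose (ba)^m.
  · have := sum_abs_transpose_row_sub_le (pow_pos hKk m) (by positivity) (hpow2 m)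
      (fun f hf => (hbound f hf).2) p
    rw [hconst] at this
    convert this using 5 with p'
    · rw [inv_pow]
    · rw [← ht, transpose_apply]
  · have := sum_abs_transpose_row_sub_le (pow_pos hKk m) (by positivity) (hpow1 m)
      (fun f hf => (hbound f hf).1) p
    rw [hconst] at this
    convert this using 5 with p'
    · rw [inv_pow]
    · rw [← ht, transpose_apply]

end Bigraph

/-! ### Total variation distance, supports and Markov kernels. -/

section Distributions

variable {α β : Type*}

theorem tvDist_nonneg [Fintype α] (μ ν : α → ℝ) : 0 ≤ tvDist μ ν := by
  unfold tvDist
  positivity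

theorem sum_uniformOn [Fintype α] [DecidableEq α] {S : Finset α} (hS : S.Nonempty) :
    ∑ a, uniformOn S a = 1 := by
  have : (S.card : ℝ) ≠ 0 := by exact_mod_cast hS.card_pos.ne'
  simp [uniformOn, this]

theorem sum_uniformOn_le [DecidableEq α] (S A : Finset α) :
    ∑ a ∈ A, uniformOn S a ≤ A.card * (S.card : ℝ)⁻¹ := by
  rw [← nsmul_eq_mul]
  refine Finset.sum_le_card_nsmul _ _ _ fun a _ => ?_
  unfold uniformOn
  split_ifs
  · exact le_rfl
  · positivity

theorem sum_sub_sum_le_tvDist [Fintype α] {μ ν : α → ℝ} (h : ∑ a, μ a = ∑ a, ν a)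
    (A : Finset α) : ∑ a ∈ A, μ a - ∑ a ∈ A, ν a ≤ tvDist μ ν := by
  classical
  have h1 := Finset.sum_add_sum_compl A fun a => μ a - ν a
  rw [Finset.sum_sub_distrib (s := Finset.univ), h, sub_self] at h1
  have h2 := Finset.sum_add_sum_compl A fun a => |μ a - ν a|
  have h3 : ∑ a ∈ A, (μ a - ν a) ≤ ∑ a ∈ A, |μ a - ν a| :=
    Finset.sum_le_sum fun a _ => le_abs_self _
  have h4 : -∑ a ∈ Aᶜ, (μ a - ν a) ≤ ∑ a ∈ Aᶜ, |μ a - ν a| := by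
    rw [← Finset.sum_neg_distrib]
    exact Finset.sum_le_sum fun a _ => neg_le_abs _
  rw [← Finset.sum_sub_distrib]
  unfold tvDist
  linarith

/-- A probability vector with entries zero or at least `c` has small support. -/
theorem card_support_le [Fintype α] {μ : α → ℝ} (h : ∑ a, μ a = 1) {c : ℝ}
    (hc : 0 < c) (hμ : ∀ a, μ a = 0 ∨ c ≤ μ a) (A : Finset α) (hA : ∀ a ∈ A, μ a ≠ 0) :
    (A.card : ℝ) ≤ c⁻¹ := by
  have h0 : ∀ a, 0 ≤ μ a := fun a => (hμ a).elim (fun h => h.ge) fun h => hc.le.trans h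
  have h1 : A.card • c ≤ ∑ a ∈ A, μ a :=
    Finset.card_nsmul_le_sum _ _ _ fun a ha => (hμ a).resolve_left (hA a ha)
  have h2 : ∑ a ∈ A, μ a ≤ 1 := h ▸ Finset.sum_le_univ_sum_of_nonneg h0
  rw [nsmul_eq_mul] at h1
  rw [← one_div, le_div_iff₀ hc]
  linarith

/-- Lower bound on the products of matrices with entries zero or bounded below. -/
theorem Matrix.mul_entry_eq_zero_or_le {γ : Type*} [Fintype β] {M : Matrix α β ℝ}
    {M' : Matrix β γ ℝ} {c c' : ℝ} (hc : 0 ≤ c) (hc' : 0 ≤ c')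
    (h : ∀ i j, M i j = 0 ∨ c ≤ M i j)
    (h' : ∀ i j, M' i j = 0 ∨ c' ≤ M' i j) (i : α) (j : γ) :
    (M * M') i j = 0 ∨ c * c' ≤ (M * M') i j := by
  have h0 : ∀ x, 0 ≤ M i x * M' x j := fun x =>
    mul_nonneg ((h i x).elim (fun h => h.ge) fun h => hc.trans h)
      ((h' x j).elim (fun h => h.ge) fun h => hc'.trans h)
  rw [Matrix.mul_apply]
  by_cases hz : ∀ x, M i x * M' x j = 0
  · exact Or.inl (Finset.sum_eq_zero fun x _ => hz x)
  · right
    push Not at hz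
    obtain ⟨x, hx⟩ := hz
    have h1 := (h i x).resolve_left (left_ne_zero_of_mul hx)
    have h2 := (h' x j).resolve_left (right_ne_zero_of_mul hx)
    exact (mul_le_mul h1 h2 hc' (hc.trans h1)).trans
      (Finset.single_le_sum (f := fun x => M i x * M' x j) (fun x _ => h0 x) (Finset.mem_univ x))

theorem Matrix.sum_row_mul {γ : Type*} [Fintype β] [Fintype γ] {M : Matrix α β ℝ}
    {M' : Matrix β γ ℝ} (h : ∀ i, ∑ j, M i j = 1) (h' : ∀ i, ∑ j, M' i j = 1) (i : α) :
    ∑ j, (M * M') i j = 1 := by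
  simp only [Matrix.mul_apply]
  rw [Finset.sum_comm]
  simp only [← Finset.mul_sum, h', mul_one, h]

theorem Matrix.sum_row_pow [Fintype α] [DecidableEq α] {M : Matrix α α ℝ}
    (h : ∀ i, ∑ j, M i j = 1) (m : ℕ) (i : α) : ∑ j, (M ^ m) i j = 1 := by
  induction m generalizing i with
  | zero => simp [Matrix.one_apply]
  | succ m ih => rw [pow_succ]; exact Matrix.sum_row_mul ih h i

/-- Averaging the starting point and mapping the final point do not increase the distance to a
fixed distribution. -/
theorem tvDist_mul_mul_le [Fintype α] {γ δ : Type*} [Fintype γ] [Fintype δ]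
    {w : δ → ℝ} (hw0 : ∀ i, 0 ≤ w i) (hw1 : ∑ i, w i = 1) {M : Matrix δ α ℝ} {H : Matrix α γ ℝ}
    (hH0 : ∀ a x, 0 ≤ H a x) (hH1 : ∀ a, ∑ x, H a x = 1) {ν : α → ℝ} {η : ℝ}
    (h : ∀ i, w i ≠ 0 → tvDist (M i) ν ≤ η) :
    tvDist (fun x => ∑ i, w i * (M * H) i x) (fun x => ∑ a, ν a * H a x) ≤ η := by
  have h1 : ∀ x, |∑ i, w i * (M * H) i x - ∑ a, ν a * H a x| ≤
      ∑ i, w i * ∑ a, |M i a - ν a| * H a x := fun x => by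
    have : ∑ i, w i * (M * H) i x - ∑ a, ν a * H a x =
        ∑ i, w i * ∑ a, (M i a - ν a) * H a x := by
      simp only [sub_mul, Finset.sum_sub_distrib, mul_sub, ← Finset.sum_mul, hw1, one_mul,
        Matrix.mul_apply]
    rw [this]
    refine (Finset.abs_sum_le_sum_abs _ _).trans (Finset.sum_le_sum fun i _ => ?_)
    rw [abs_mul, abs_of_nonneg (hw0 i)]
    refine mul_le_mul_of_nonneg_left ((Finset.abs_sum_le_sum_abs _ _).trans
      (Finset.sum_le_sum fun a _ => ?_)) (hw0 i)
    rw [abs_mul, abs_of_nonneg (hH0 a x)]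
  have h2 : ∑ x, ∑ i, w i * ∑ a, |M i a - ν a| * H a x = ∑ i, w i * ∑ a, |M i a - ν a| := by
    rw [Finset.sum_comm]
    refine Finset.sum_congr rfl fun i _ => ?_
    rw [← Finset.mul_sum, Finset.sum_comm]
    simp only [← Finset.mul_sum, hH1, mul_one]
  have h3 : ∑ i, w i * ∑ a, |M i a - ν a| ≤ ∑ i, w i * (2 * η) := by
    refine Finset.sum_le_sum fun i _ => ?_
    by_cases hi : w i = 0
    · simp [hi]
    · have := h i hi
      unfold tvDist at this
      exact mul_le_mul_of_nonneg_left (by linarith) (hw0 i)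
  rw [← Finset.sum_mul, hw1, one_mul] at h3
  unfold tvDist
  have h4 := Finset.sum_le_sum fun x (_ : x ∈ Finset.univ) => h1 x
  linarith

end Distributions

/-! ### Two-sided bounds for the non-backtracking walk. -/

namespace Bigraph

open Matrix

variable {K k : ℕ} (X : Bigraph.{u} K k)

theorem sum_dart {M : Type*} [AddCommMonoid M] (g : X.graph.Dart → M) :
    ∑ e, g e = ∑ p, g (X.dartEquiv (Sum.inl p)) + ∑ p, g (X.dartEquiv (Sum.inr p)) := by
  rw [← X.dartEquiv.sum_comp, Fintype.sum_sum_type]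

theorem card_filter_dart (s : Bool) :
    (Finset.univ.filter fun e : X.graph.Dart => e.fst.isLeft = s).card = Fintype.card X.Edge := by
  rw [Finset.card_filter, sum_dart]
  cases s <;> simp

theorem edgeCard_eq : X.edgeCard = Fintype.card X.Edge := X.card_filter_dart true

theorem card_edge_left : Fintype.card X.Edge = X.leftCard * (K + 1) := by
  rw [leftCard, Fintype.card, Finset.card_eq_sum_card_fiberwise (f := fun p : X.Edge => p.1.1)
    (t := Finset.univ) (fun _ _ => Finset.mem_coe.2 (Finset.mem_univ _))]
  simp [X.card_filter_left]

theorem card_edge_right : Fintype.card X.Edge = Fintype.card X.R * (k + 1) := by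
  rw [Fintype.card, Finset.card_eq_sum_card_fiberwise (f := fun p : X.Edge => p.1.2)
    (t := Finset.univ) (fun _ _ => Finset.mem_coe.2 (Finset.mem_univ _))]
  simp [X.card_filter_right]

instance : Nonempty X.Edge := by
  obtain ⟨v⟩ := X.connected.nonempty
  rcases v with l | r
  · have := X.card_filter_left l
    obtain ⟨p, -⟩ := Finset.card_pos.1 (by rw [this]; exact Nat.succ_pos K)
    exact ⟨p⟩
  · have := X.card_filter_right r
    obtain ⟨p, -⟩ := Finset.card_pos.1 (by rw [this]; exact Nat.succ_pos k)
    exact ⟨p⟩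

theorem edgeCard_pos : 0 < X.edgeCard := by
  rw [edgeCard_eq]
  exact Fintype.card_pos

theorem edgeCard_eq_leftCard_mul : X.edgeCard = X.leftCard * (K + 1) := by
  rw [edgeCard_eq, card_edge_left]

theorem leftCard_pos : 0 < X.leftCard :=
  Nat.pos_of_ne_zero fun h => X.edgeCard_pos.ne' (by rw [edgeCard_eq_leftCard_mul, h, zero_mul])

/-- The two-step non-backtracking walk preserves orientations. -/
theorem nbrwMatrix_pow_submatrix (m : ℕ) :
    ((nbrwMatrix X.graph) ^ (2 * m)).submatrix X.dartEquiv X.dartEquiv =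
      fromBlocks (((K : ℝ) * k)⁻¹ ^ m • (X.rightMatrix ℝ * X.leftMatrix ℝ) ^ m) 0 0
        (((K : ℝ) * k)⁻¹ ^ m • (X.leftMatrix ℝ * X.rightMatrix ℝ) ^ m) := by
  have h : ∀ s : ℕ, ((nbrwMatrix X.graph) ^ s).submatrix X.dartEquiv X.dartEquiv =
      ((nbrwMatrix X.graph).submatrix X.dartEquiv X.dartEquiv) ^ s := fun s => by
    have := map_pow (Matrix.reindexAlgEquiv ℝ ℝ X.dartEquiv.symm) (nbrwMatrix X.graph) s
    simpa only [coe_reindexAlgEquiv, reindex_apply, Equiv.symm_symm] using this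
  rw [h, pow_mul, nbrwMatrix_submatrix, pow_two, fromBlocks_multiply]
  simp only [zero_mul, mul_zero, zero_add, add_zero]
  rw [fromBlocks_diagonal_pow, smul_mul_smul_comm, smul_mul_smul_comm, smul_pow, smul_pow,
    _root_.mul_inv_rev, mul_comm (K : ℝ)⁻¹]

theorem nbrwMatrix_entry (hk : 1 ≤ k) (hkK : k < K) (e f : X.graph.Dart) :
    nbrwMatrix X.graph e f = 0 ∨ (K : ℝ)⁻¹ ≤ nbrwMatrix X.graph e f := by
  have hk' : (0 : ℝ) < k := by exact_mod_cast hk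
  have h1 : (K : ℝ)⁻¹ ≤ (k : ℝ)⁻¹ := inv_anti₀ hk' (by exact_mod_cast hkK.le)
  obtain ⟨e, rfl⟩ := X.dartEquiv.surjective e
  obtain ⟨f, rfl⟩ := X.dartEquiv.surjective f
  rw [← submatrix_apply (nbrwMatrix X.graph) X.dartEquiv X.dartEquiv, nbrwMatrix_submatrix]
  rcases e with p | p <;> rcases f with p' | p'
  · exact Or.inl rfl
  · rw [fromBlocks_apply₁₂, Matrix.smul_apply, smul_eq_mul, rightMatrix, of_apply]
    split_ifs
    · exact Or.inr (by rwa [mul_one])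
    · exact Or.inl (mul_zero _)
  · rw [fromBlocks_apply₂₁, Matrix.smul_apply, smul_eq_mul, leftMatrix, of_apply]
    split_ifs
    · exact Or.inr (by rw [mul_one])
    · exact Or.inl (mul_zero _)
  · exact Or.inl rfl

theorem nbrwMatrix_nonneg (hk : 1 ≤ k) (hkK : k < K) (e f : X.graph.Dart) :
    0 ≤ nbrwMatrix X.graph e f :=
  (X.nbrwMatrix_entry hk hkK e f).elim (fun h => h.ge) fun h =>
    (by positivity : (0 : ℝ) ≤ _).trans h

theorem nbrwMatrix_row_sum (hk : 1 ≤ k) (hkK : k < K) (e : X.graph.Dart) :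
    ∑ f, nbrwMatrix X.graph e f = 1 := by
  have hk' : (k : ℝ) ≠ 0 := by exact_mod_cast (by omega : k ≠ 0)
  have hK' : (K : ℝ) ≠ 0 := by exact_mod_cast (by omega : K ≠ 0)
  obtain ⟨e, rfl⟩ := X.dartEquiv.surjective e
  have h : ∀ f, nbrwMatrix X.graph (X.dartEquiv e) (X.dartEquiv f) =
      (fromBlocks 0 ((k : ℝ)⁻¹ • X.rightMatrix ℝ) ((K : ℝ)⁻¹ • X.leftMatrix ℝ) 0) e f := fun f => by
    rw [← nbrwMatrix_submatrix, submatrix_apply]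
  rw [sum_dart]
  simp only [h]
  rcases e with p | p
  · have := congrFun X.rightMatrix_mulVec_one p
    simp only [mulVec, dotProduct, Pi.one_apply, mul_one, Pi.smul_apply, smul_eq_mul] at this
    simp [← Finset.mul_sum, this, hk']
  · have := congrFun X.leftMatrix_mulVec_one p
    simp only [mulVec, dotProduct, Pi.one_apply, mul_one, Pi.smul_apply, smul_eq_mul] at this
    simp [← Finset.mul_sum, this, hK']

theorem isLeft_of_adj {v w : X.L ⊕ X.R} (h : X.graph.Adj v w) : w.isLeft = !v.isLeft := by
  rcases v with l | r <;> rcases w with l' | r'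
  · exact absurd h (X.not_adj_inl _ _)
  · rfl
  · rfl
  · exact absurd h (X.not_adj_inr _ _)

theorem isLeft_of_nbrwMatrix_ne_zero {e f : X.graph.Dart} (h : nbrwMatrix X.graph e f ≠ 0) :
    f.fst.isLeft = !e.fst.isLeft := by
  simp only [nbrwMatrix, of_apply, ne_eq, ite_eq_right_iff, not_forall] at h
  obtain ⟨⟨h1, -⟩, -⟩ := h
  rw [← h1]
  exact X.isLeft_of_adj e.adj

theorem isLeft_of_nbrwMatrix_pow_ne_zero (m : ℕ) {e f : X.graph.Dart}
    (h : (nbrwMatrix X.graph ^ m) e f ≠ 0) : f.fst.isLeft = (not^[m]) e.fst.isLeft := by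
  induction m generalizing f with
  | zero =>
    rw [pow_zero, one_apply] at h
    obtain rfl : e = f := by
      by_contra hne
      simp [hne] at h
    rfl
  | succ m ih =>
    rw [pow_succ, mul_apply] at h
    obtain ⟨g, -, hg⟩ := Finset.exists_ne_zero_of_sum_ne_zero h
    rw [Function.iterate_succ_apply', ← ih (left_ne_zero_of_mul hg)]
    exact X.isLeft_of_nbrwMatrix_ne_zero (right_ne_zero_of_mul hg)

theorem iterate_not_two_mul (m : ℕ) (b : Bool) : (not^[2 * m]) b = b := by
  rw [Function.iterate_mul, show (not^[2]) = id by funext b; simp, Function.iterate_id, id]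

theorem nbrwMatrix_pow_even_entry (m : ℕ) (e f : X.graph.Dart) :
    (nbrwMatrix X.graph ^ (2 * m)) e f = 0 ∨
      ((K : ℝ) * k)⁻¹ ^ m ≤ (nbrwMatrix X.graph ^ (2 * m)) e f := by
  have hr : ∀ p p', X.rightMatrix ℝ p p' = 0 ∨ 1 ≤ X.rightMatrix ℝ p p' := fun p p' => by
    simp only [rightMatrix, of_apply]
    split_ifs <;> simp
  have hl : ∀ p p', X.leftMatrix ℝ p p' = 0 ∨ 1 ≤ X.leftMatrix ℝ p p' := fun p p' => by
    simp only [leftMatrix, of_apply]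
    split_ifs <;> simp
  have hpow : ∀ M : Matrix X.Edge X.Edge ℝ, (∀ p p', M p p' = 0 ∨ 1 ≤ M p p') →
      ∀ p p', (M ^ m) p p' = 0 ∨ 1 ≤ (M ^ m) p p' := by
    intro M hM
    induction m with
    | zero =>
      intro p p'
      rw [pow_zero, one_apply]
      split_ifs <;> simp
    | succ m ih =>
      rw [pow_succ]
      simpa using Matrix.mul_entry_eq_zero_or_le zero_le_one zero_le_one ih hM
  have h1 := hpow _ (by simpa using Matrix.mul_entry_eq_zero_or_le zero_le_one zero_le_one hr hl)
  have h2 := hpow _ (by simpa using Matrix.mul_entry_eq_zero_or_le zero_le_one zero_le_one hl hr)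
  have hc : 0 ≤ ((K : ℝ) * k)⁻¹ ^ m := by positivity
  obtain ⟨e, rfl⟩ := X.dartEquiv.surjective e
  obtain ⟨f, rfl⟩ := X.dartEquiv.surjective f
  rw [← submatrix_apply (nbrwMatrix X.graph ^ (2 * m)) X.dartEquiv X.dartEquiv,
    nbrwMatrix_pow_submatrix]
  rcases e with p | p <;> rcases f with p' | p'
  · rw [fromBlocks_apply₁₁, Matrix.smul_apply, smul_eq_mul]
    rcases h1 p p' with h | h
    · exact Or.inl (by rw [h, mul_zero])
    · exact Or.inr (le_mul_of_one_le_right hc h)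
  · exact Or.inl rfl
  · exact Or.inl rfl
  · rw [fromBlocks_apply₂₂, Matrix.smul_apply, smul_eq_mul]
    rcases h2 p p' with h | h
    · exact Or.inl (by rw [h, mul_zero])
    · exact Or.inr (le_mul_of_one_le_right hc h)

/-- A pair of consecutive steps has probability 1/(Kk) in either orientation; a leftover step costs
at worst 1/K because k < K. -/
theorem nbrwMatrix_pow_entry (hk : 1 ≤ k) (hkK : k < K) (m : ℕ) (e f : X.graph.Dart) :
    (nbrwMatrix X.graph ^ m) e f = 0 ∨
      (K : ℝ)⁻¹ * ((K : ℝ) * k)⁻¹ ^ (m / 2) ≤ (nbrwMatrix X.graph ^ m) e f := by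
  have hK : (1 : ℝ) ≤ K := by exact_mod_cast (by omega : 1 ≤ K)
  have hc : 0 ≤ ((K : ℝ) * k)⁻¹ ^ (m / 2) := by positivity
  rcases Nat.even_or_odd' m with ⟨j, rfl | rfl⟩
  · rw [Nat.mul_div_cancel_left _ two_pos] at hc ⊢
    refine (X.nbrwMatrix_pow_even_entry j e f).imp_right fun h => le_trans ?_ h
    exact mul_le_of_le_one_left hc (inv_le_one_of_one_le₀ hK)
  · rw [show (2 * j + 1) / 2 = j by omega] at hc ⊢
    rw [pow_succ']
    exact Matrix.mul_entry_eq_zero_or_le (by positivity) hc (X.nbrwMatrix_entry hk hkK)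
      (X.nbrwMatrix_pow_even_entry j) e f

/-- The uniform distribution on the directed edges of a given orientation. -/
noncomputable abbrev uniformDart (s : Bool) : X.graph.Dart → ℝ :=
  uniformOn (Finset.univ.filter fun e : X.graph.Dart => e.fst.isLeft = s)

theorem uniformDart_apply (s : Bool) (e : X.graph.Dart) :
    X.uniformDart s e = if e.fst.isLeft = s then (X.edgeCard : ℝ)⁻¹ else 0 := by
  simp only [uniformDart, uniformOn, Finset.mem_filter, Finset.mem_univ, true_and,
    card_filter_dart, edgeCard_eq]

theorem sum_uniformDart (s : Bool) : ∑ e, X.uniformDart s e = 1 := by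
  apply sum_uniformOn
  rw [← Finset.card_pos, card_filter_dart]
  exact Fintype.card_pos

/-- Upper bound on the distance to equilibrium of the non-backtracking walk at even times. -/
theorem tvDist_nbrw_even_le (hX : X.IsRamanujan) (hk : 1 ≤ k) (hkK : k < K) (m : ℕ)
    (e : X.graph.Dart) :
    tvDist ((nbrwMatrix X.graph ^ (2 * m)) e) (X.uniformDart e.fst.isLeft) ≤
      √X.edgeCard * ((√(K * k) + 1) * (m + 1) * (√(K * k))⁻¹ ^ m) := by
  obtain ⟨e, rfl⟩ := X.dartEquiv.surjective e
  have h : ∀ f, (nbrwMatrix X.graph ^ (2 * m)) (X.dartEquiv e) (X.dartEquiv f) =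
      (fromBlocks (((K : ℝ) * k)⁻¹ ^ m • (X.rightMatrix ℝ * X.leftMatrix ℝ) ^ m) 0 0
        (((K : ℝ) * k)⁻¹ ^ m • (X.leftMatrix ℝ * X.rightMatrix ℝ) ^ m)) e f := fun f => by
    rw [← nbrwMatrix_pow_submatrix, submatrix_apply]
  rw [tvDist, sum_dart]
  simp only [h, uniformDart_apply, edgeCard_eq]
  have hb := fun p => X.sum_abs_row_sub_le hX hk hkK m p
  have hnn : 0 ≤ √(Fintype.card X.Edge) * ((√(K * k) + 1) * (m + 1) * (√(K * k))⁻¹ ^ m) := by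
    positivity
  rcases e with p | p
  · have := (hb p).1
    simp only [fromBlocks_apply₁₁, fromBlocks_apply₁₂, Matrix.smul_apply, smul_eq_mul,
      dartEquiv_inl_fst, dartEquiv_inr_fst, Sum.isLeft_inl, Sum.isLeft_inr, if_true,
      Matrix.zero_apply, reduceCtorEq, if_false, sub_self, abs_zero, Finset.sum_const_zero,
      add_zero]
    linarith
  · have := (hb p).2
    simp only [fromBlocks_apply₂₁, fromBlocks_apply₂₂, Matrix.smul_apply, smul_eq_mul,
      dartEquiv_inl_fst, dartEquiv_inr_fst, Sum.isLeft_inl, Sum.isLeft_inr, if_true,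
      Matrix.zero_apply, reduceCtorEq, if_false, sub_self, abs_zero, Finset.sum_const_zero,
      zero_add]
    linarith

theorem tvDist_nbrw_le (hX : X.IsRamanujan) (hk : 1 ≤ k) (hkK : k < K) (m : ℕ)
    (e : X.graph.Dart) :
    tvDist ((nbrwMatrix X.graph ^ m) e) (X.uniformDart ((not^[m]) e.fst.isLeft)) ≤
      √X.edgeCard * ((√(K * k) + 1) * ((m / 2 : ℕ) + 1) * (√(K * k))⁻¹ ^ (m / 2)) := by
  rcases Nat.even_or_odd' m with ⟨j, rfl | rfl⟩
  · rw [Nat.mul_div_cancel_left _ two_pos, iterate_not_two_mul]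
    exact X.tvDist_nbrw_even_le hX hk hkK j e
  · rw [show (2 * j + 1) / 2 = j by omega, Function.iterate_succ_apply, iterate_not_two_mul]
    -- At odd times, average the even-time bound over the first step, which always reverses the
    -- orientation.
    have := tvDist_mul_mul_le (w := nbrwMatrix X.graph e) (X.nbrwMatrix_nonneg hk hkK e)
      (X.nbrwMatrix_row_sum hk hkK e) (M := nbrwMatrix X.graph ^ (2 * j)) (H := 1)
      (fun a x => by rw [one_apply]; split_ifs <;> simp) (fun a => by simp [one_apply])
      (ν := X.uniformDart (!e.fst.isLeft)) fun f hf => by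
        have := X.tvDist_nbrw_even_le hX hk hkK j f
        rwa [X.isLeft_of_nbrwMatrix_ne_zero hf] at this
    convert this using 2
    · ext x
      rw [pow_succ', mul_apply]
      simp
    · ext x
      simp [one_apply]

/-- Lower bound on the distance to equilibrium of the non-backtracking walk at even times. -/
theorem le_tvDist_nbrw (hk : 1 ≤ k) (hkK : k < K) (m : ℕ) (e : X.graph.Dart) :
    1 - ((K : ℝ) * k) ^ m / X.edgeCard ≤
      tvDist ((nbrwMatrix X.graph ^ (2 * m)) e) (X.uniformDart e.fst.isLeft) := by
  classical
  have hKk : (0 : ℝ) < K * k := by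
    have : 0 < K * k := Nat.mul_pos (by omega) (by omega)
    exact_mod_cast this
  have hrow := Matrix.sum_row_pow (X.nbrwMatrix_row_sum hk hkK) (2 * m) e
  -- The law lives on A, which has at most (Kk)^m elements, whereas the uniform law gives A mass at
  -- most (Kk)^m / N.
  set A := Finset.univ.filter fun f => (nbrwMatrix X.graph ^ (2 * m)) e f ≠ 0 with hA
  have h1 := card_support_le hrow (by positivity) (X.nbrwMatrix_pow_even_entry m e) A
    (fun f hf => (Finset.mem_filter.1 hf).2)
  rw [← inv_pow, inv_inv] at h1
  have h2 : ∑ f ∈ A, (nbrwMatrix X.graph ^ (2 * m)) e f = 1 := by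
    rw [hA, Finset.sum_filter_ne_zero, hrow]
  have h3 := sum_sub_sum_le_tvDist
    (hrow.trans (X.sum_uniformDart e.fst.isLeft).symm) A
  have h4 := sum_uniformOn_le (Finset.univ.filter fun f : X.graph.Dart =>
    f.fst.isLeft = e.fst.isLeft) A
  rw [card_filter_dart, ← edgeCard_eq, ← div_eq_mul_inv] at h4
  have h5 : (A.card : ℝ) / X.edgeCard ≤ ((K : ℝ) * k) ^ m / X.edgeCard := by gcongr
  rw [h2] at h3
  change _ - ∑ f ∈ A, uniformOn _ f ≤ _ at h3
  linarith

end Bigraph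

/-! ### Concentration of the distance chain on the tree. -/

section DistanceChain

/-- Transition operator of the nearest-neighbour chain on `ℕ` reflected at `0` which moves from
`d > 0` to `d - 1` with probability `ρ d`. -/
noncomputable def distStep (ρ : ℕ → ℝ) : Module.End ℝ (ℕ → ℝ) where
  toFun g d := match d with
    | 0 => g 1
    | d + 1 => (1 - ρ (d + 1)) * g (d + 2) + ρ (d + 1) * g d
  map_add' g g' := by
    ext (_ | d)
    · rfl
    · simp only [Pi.add_apply]
      ring
  map_smul' c g := by
    ext (_ | d)
    · rfl
    · simp only [Pi.smul_apply, smul_eq_mul, RingHom.id_apply]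
      ring

theorem distStep_zero (ρ g : ℕ → ℝ) : distStep ρ g 0 = g 1 := rfl

theorem distStep_succ (ρ g : ℕ → ℝ) (d : ℕ) :
    distStep ρ g (d + 1) = (1 - ρ (d + 1)) * g (d + 2) + ρ (d + 1) * g d := rfl

variable {ρ : ℕ → ℝ}

theorem distStep_mono (h0 : ∀ d, 0 ≤ ρ d) (h1 : ∀ d, ρ d ≤ 1) {g g' : ℕ → ℝ}
    (h : ∀ d, g d ≤ g' d) (d : ℕ) : distStep ρ g d ≤ distStep ρ g' d := by
  cases d with
  | zero => exact h 1
  | succ d =>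
    rw [distStep_succ, distStep_succ]
    exact add_le_add (mul_le_mul_of_nonneg_left (h _) (sub_nonneg.2 (h1 _)))
      (mul_le_mul_of_nonneg_left (h _) (h0 _))

theorem distStep_pow_mono (h0 : ∀ d, 0 ≤ ρ d) (h1 : ∀ d, ρ d ≤ 1) (s : ℕ) {g g' : ℕ → ℝ}
    (h : ∀ d, g d ≤ g' d) (d : ℕ) : (distStep ρ ^ s) g d ≤ (distStep ρ ^ s) g' d := by
  induction s generalizing d with
  | zero => exact h d
  | succ s ih =>
    rw [pow_succ', Module.End.mul_apply, Module.End.mul_apply]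
    exact distStep_mono h0 h1 ih d

theorem distStep_pow_const (s : ℕ) (c : ℝ) : (distStep ρ ^ s) (fun _ => c) = fun _ => c := by
  induction s with
  | zero => rfl
  | succ s ih =>
    rw [pow_succ, Module.End.mul_apply, show distStep ρ (fun _ => c) = fun _ => c from ?_, ih]
    ext (_ | d)
    · rfl
    · rw [distStep_succ]
      ring

/-- Second moment bound around the drift `ν` for a height function `h` of constant drift. -/
theorem distStep_pow_sq_le (h0 : ∀ d, 0 ≤ ρ d) (h1 : ∀ d, ρ d ≤ 1) {h : ℕ → ℝ} {ν c : ℝ}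
    (hh0 : h 0 = 0) (hν0 : 0 ≤ ν) (hν : ν ≤ h 1)
    (hdrift : ∀ d, (1 - ρ (d + 1)) * h (d + 2) + ρ (d + 1) * h d = h (d + 1) + ν)
    (hup : ∀ d, (h (d + 1) - h d - ν) ^ 2 ≤ c) (hdown : ∀ d, (h d - h (d + 1) - ν) ^ 2 ≤ c)
    (s : ℕ) {t : ℝ} (ht : 0 ≤ t) (d : ℕ) :
    (distStep ρ ^ s) (fun d => (h d - ν * (t + s)) ^ 2) d ≤ (h d - ν * t) ^ 2 + c * s := by
  -- The parameter t is the time already elapsed; keeping it free allows the first step to be peeled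
  -- off.
  induction s generalizing t d with
  | zero => simp
  | succ s ih =>
    rw [pow_succ', Module.End.mul_apply]
    have e : (fun d => (h d - ν * (t + (s + 1 : ℕ))) ^ 2) =
        fun d => (h d - ν * ((t + 1) + s)) ^ 2 := by
      ext d
      push_cast
      ring
    rw [e]
    refine (distStep_mono h0 h1 (fun d => ih (by linarith : 0 ≤ t + 1) d) d).trans ?_
    push_cast
    cases d with
    | zero =>
      rw [distStep_zero]
      have := hup 0
      rw [hh0] at this ⊢
      -- At the reflecting point the drift exceeds ν, but there h - νt ≤ 0, so the cross term -2νt(h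
      -- 1 - ν) has the favourable sign.
      nlinarith [mul_nonneg (mul_nonneg hν0 ht) (sub_nonneg.2 hν)]
    | succ d =>
      rw [distStep_succ]
      have e1 := hdrift d
      have e2 := mul_le_mul_of_nonneg_left (hup (d + 1)) (sub_nonneg.2 (h1 (d + 1)))
      have e3 := mul_le_mul_of_nonneg_left (hdown d) (h0 (d + 1))
      set x := h (d + 1) - ν * t
      -- Expand around x: the cross term carries the drift minus ν, which vanishes, and only the
      -- squared increments remain.
      have e4 : (1 - ρ (d + 1)) * ((h (d + 2) - ν * (t + 1)) ^ 2 + c * s) +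
          ρ (d + 1) * ((h d - ν * (t + 1)) ^ 2 + c * s) =
          x ^ 2 + c * s + 2 * x * ((1 - ρ (d + 1)) * h (d + 2) + ρ (d + 1) * h d -
            h (d + 1) - ν) + (1 - ρ (d + 1)) * (h (d + 1 + 1) - h (d + 1) - ν) ^ 2 +
          ρ (d + 1) * (h d - h (d + 1) - ν) ^ 2 := by
        simp only [x]
        ring
      rw [e4, e1]
      linarith

/-- Concentration of the chain whose backtracking probability alternates between `x` (at even
distance) and `y` (at odd distance), around the speed `1 - x - y`. -/
theorem distStep_pow_indicator_le {x y : ℝ} (hx0 : 0 ≤ x) (hy0 : 0 ≤ y) (hx : x ≤ 1 / 2)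
    (hy : y ≤ 1 / 2) (hρ : ∀ d, ρ d = if Even d then x else y) (s : ℕ)
    {B : ℕ → Prop} [DecidablePred B] {r : ℝ} (hr : 0 < r)
    (hB : ∀ d, B d → r + 1 ≤ |(d : ℝ) - (1 - x - y) * s|) :
    (distStep ρ ^ s) (fun d => if B d then 1 else 0) 0 ≤ 9 * s / r ^ 2 := by
  have h0 : ∀ d, 0 ≤ ρ d := fun d => by rw [hρ]; split_ifs <;> assumption
  have h1 : ∀ d, ρ d ≤ 1 := fun d => by rw [hρ]; split_ifs <;> linarith
  -- The drift of the distance alternates between 1 - 2x and 1 - 2y. Adding x - y at odd distances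
  -- equalises it to 1 - x - y at every positive distance.
  set h : ℕ → ℝ := fun d => d + if Even d then 0 else x - y with hh
  have hev : ∀ d, Even d → h d = d ∧ h (d + 1) = d + 1 + (x - y) ∧ h (d + 2) = d + 2 := by
    intro d hd
    have hd1 : ¬ Even (d + 1) := by simpa [Nat.even_add_one] using hd
    have hd2 : Even (d + 2) := by simpa [Nat.even_add] using hd
    refine ⟨?_, ?_, ?_⟩ <;> simp only [hh, hd, hd1, hd2, if_true, if_false] <;> push_cast <;> ring
  have hod : ∀ d, ¬ Even d → h d = d + (x - y) ∧ h (d + 1) = d + 1 ∧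
      h (d + 2) = d + 2 + (x - y) := by
    intro d hd
    have hd1 : Even (d + 1) := by simpa [Nat.even_add_one] using hd
    have hd2 : ¬ Even (d + 2) := by simpa [Nat.even_add] using hd
    refine ⟨?_, ?_, ?_⟩ <;> simp only [hh, hd, hd1, hd2, if_true, if_false] <;> push_cast <;> ring
  -- Centred increments of h are at most 3 in absolute value, whence the variance constant c = 9.
  have hsq : ∀ z : ℝ, -3 ≤ z → z ≤ 3 → z ^ 2 ≤ 9 := fun z hz hz' => by nlinarith
  have key := distStep_pow_sq_le h0 h1 (h := h) (ν := 1 - x - y) (c := 9)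
    (by simp [hh]) (by linarith) (by simp [hh]; linarith)
    (fun d => by
      by_cases hd : Even d
      · obtain ⟨e1, e2, e3⟩ := hev d hd
        have hd1 : ¬ Even (d + 1) := by simpa [Nat.even_add_one] using hd
        rw [e1, e2, e3, hρ, if_neg hd1]
        ring
      · obtain ⟨e1, e2, e3⟩ := hod d hd
        have hd1 : Even (d + 1) := by simpa [Nat.even_add_one] using hd
        rw [e1, e2, e3, hρ, if_pos hd1]
        ring)
    (fun d => by
      by_cases hd : Even d
      · obtain ⟨e1, e2, -⟩ := hev d hd
        rw [e1, e2]
        apply hsq <;> linarith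
      · obtain ⟨e1, e2, -⟩ := hod d hd
        rw [e1, e2]
        apply hsq <;> linarith)
    (fun d => by
      by_cases hd : Even d
      · obtain ⟨e1, e2, -⟩ := hev d hd
        rw [e1, e2]
        apply hsq <;> linarith
      · obtain ⟨e1, e2, -⟩ := hod d hd
        rw [e1, e2]
        apply hsq <;> linarith) s le_rfl 0
  -- Chebyshev's inequality; the extra 1 in the hypothesis on B pays for replacing d by h d.
  have hle : ∀ d, (if B d then (1 : ℝ) else 0) ≤
      ((r ^ 2)⁻¹ • fun d => (h d - (1 - x - y) * (0 + s)) ^ 2) d := by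
    intro d
    simp only [Pi.smul_apply, smul_eq_mul, zero_add]
    split_ifs with hd
    · rw [inv_mul_eq_div, one_le_div (by positivity)]
      have h2 : |h d - d| ≤ 1 := by
        simp only [hh, add_sub_cancel_left]
        rw [abs_le]
        split_ifs <;> constructor <;> linarith
      have h3 := hB d hd
      have h4 : |(d : ℝ) - (1 - x - y) * s| ≤ |h d - (1 - x - y) * s| + |h d - d| := by
        have := abs_sub (h d - (1 - x - y) * s) (h d - d)
        rwa [show h d - (1 - x - y) * s - (h d - d) = d - (1 - x - y) * s by ring] at this
      rw [← sq_abs (h d - _)]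
      exact pow_le_pow_left₀ hr.le (by linarith) 2
    · positivity
  refine (distStep_pow_mono h0 h1 s hle 0).trans ?_
  rw [map_smul, Pi.smul_apply, smul_eq_mul, inv_mul_eq_div]
  gcongr
  refine key.trans (le_of_eq ?_)
  simp [hh]

end DistanceChain

/-! ### The simple walk as a mixture of non-backtracking paths. -/

namespace Bigraph

open Matrix

variable {K k : ℕ} (X : Bigraph.{u} K k)

/-- The probability of stepping back to a given neighbour, by the side of the current vertex. -/
noncomputable def backProb (K k : ℕ) (s : Bool) : ℝ := cond s ((K : ℝ) + 1)⁻¹ ((k : ℝ) + 1)⁻¹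

theorem backProb_nonneg (s : Bool) : 0 ≤ backProb K k s := by
  cases s <;> simp only [backProb, cond_true, cond_false] <;> positivity

theorem backProb_le_half (hk : 1 ≤ k) (hkK : k < K) (s : Bool) : backProb K k s ≤ 1 / 2 := by
  have hk' : (1 : ℝ) ≤ k := by exact_mod_cast hk
  have hK' : (1 : ℝ) ≤ K := by exact_mod_cast (by omega : 1 ≤ K)
  rw [one_div]
  cases s <;> simp only [backProb, cond_true, cond_false] <;>
    exact inv_anti₀ (by norm_num) (by linarith)

theorem inv_degree (v : X.L ⊕ X.R) : (X.graph.degree v : ℝ)⁻¹ = backProb K k v.isLeft := by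
  rcases v with l | r
  · rw [X.degree_left]
    simp [backProb]
  · rw [X.degree_right]
    simp [backProb]

theorem backProb_le (hkK : k < K) (s : Bool) : ((K : ℝ) + 1)⁻¹ ≤ backProb K k s := by
  have : (k : ℝ) ≤ K := by exact_mod_cast hkK.le
  cases s
  · exact inv_anti₀ (by positivity) (by linarith)
  · exact le_rfl

/-- From a vertex to a uniform directed edge out of it. -/
noncomputable def startMatrix : Matrix (X.L ⊕ X.R) X.graph.Dart ℝ :=
  Matrix.of fun v e => if e.fst = v then (X.graph.degree v : ℝ)⁻¹ else 0

/-- From a directed edge to its end. -/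
def endMatrix : Matrix X.graph.Dart (X.L ⊕ X.R) ℝ :=
  Matrix.of fun e x => if e.snd = x then 1 else 0

/-- From a directed edge to its origin. -/
def originMatrix : Matrix X.graph.Dart (X.L ⊕ X.R) ℝ :=
  Matrix.of fun e x => if e.fst = x then 1 else 0

/-- Law of the end of a uniform non-backtracking path of given length. -/
noncomputable def pathMatrix : ℕ → Matrix (X.L ⊕ X.R) (X.L ⊕ X.R) ℝ
  | 0 => 1
  | d + 1 => X.startMatrix * nbrwMatrix X.graph ^ d * X.endMatrix

theorem sum_dart_fst (u : X.L ⊕ X.R) (g : X.L ⊕ X.R → ℝ) :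
    ∑ f : X.graph.Dart, (if f.fst = u then g f.snd else 0) =
      ∑ y, if X.graph.Adj u y then g y else 0 := by
  rw [← Finset.sum_filter, ← Finset.sum_filter]
  refine Finset.sum_bij (fun f _ => f.snd) ?_ ?_ ?_ (fun _ _ => rfl)
  · intro f hf
    rw [Finset.mem_filter] at hf ⊢
    exact ⟨Finset.mem_univ _, hf.2 ▸ f.adj⟩
  · intro f hf f' hf' h
    rw [Finset.mem_filter] at hf hf'
    exact SimpleGraph.Dart.ext _ _ (Prod.ext (hf.2.trans hf'.2.symm) h)
  · intro y hy
    rw [Finset.mem_filter] at hy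
    exact ⟨⟨(u, y), hy.2⟩, by simp, rfl⟩

theorem sum_ite_adj (u : X.L ⊕ X.R) (c : ℝ) :
    (∑ y, if X.graph.Adj u y then c else 0) = X.graph.degree u * c := by
  rw [← Finset.sum_filter, Finset.sum_const, nsmul_eq_mul, ← SimpleGraph.neighborFinset_eq_filter,
    SimpleGraph.card_neighborFinset_eq_degree]

theorem degree_pos (v : X.L ⊕ X.R) : (0 : ℝ) < X.graph.degree v := by
  rw [← inv_pos, inv_degree]
  cases v.isLeft <;> simp only [backProb, cond_true, cond_false] <;> positivity

theorem sum_startMatrix (v : X.L ⊕ X.R) : ∑ e, X.startMatrix v e = 1 := by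
  simp only [startMatrix, of_apply]
  rw [X.sum_dart_fst v fun _ => (X.graph.degree v : ℝ)⁻¹, sum_ite_adj,
    mul_inv_cancel₀ (X.degree_pos v).ne']

theorem sum_endMatrix (e : X.graph.Dart) : ∑ x, X.endMatrix e x = 1 := by
  simp [endMatrix]

theorem endMatrix_nonneg (e : X.graph.Dart) (x : X.L ⊕ X.R) : 0 ≤ X.endMatrix e x := by
  simp only [endMatrix, of_apply]
  split_ifs <;> simp

theorem startMatrix_entry (hkK : k < K) (v : X.L ⊕ X.R) (e : X.graph.Dart) :
    X.startMatrix v e = 0 ∨ ((K : ℝ) + 1)⁻¹ ≤ X.startMatrix v e := by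
  simp only [startMatrix, of_apply, inv_degree]
  split_ifs
  · exact Or.inr (backProb_le hkK _)
  · exact Or.inl rfl

theorem startMatrix_nonneg (v : X.L ⊕ X.R) (e : X.graph.Dart) : 0 ≤ X.startMatrix v e := by
  simp only [startMatrix, of_apply]
  split_ifs <;> positivity

theorem endMatrix_entry (e : X.graph.Dart) (x : X.L ⊕ X.R) :
    X.endMatrix e x = 0 ∨ 1 ≤ X.endMatrix e x := by
  simp only [endMatrix, of_apply]
  split_ifs <;> simp

theorem startMatrix_mul_endMatrix : X.startMatrix * X.endMatrix = srwMatrix X.graph := by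
  ext v y
  rw [mul_apply]
  simp only [startMatrix, endMatrix, of_apply, srwMatrix, ite_mul, zero_mul]
  rw [X.sum_dart_fst v fun x => (X.graph.degree v : ℝ)⁻¹ * if x = y then 1 else 0]
  rw [Finset.sum_eq_single y]
  · simp
  · intro b _ hb
    simp [hb]
  · simp

theorem startMatrix_mul_originMatrix : X.startMatrix * X.originMatrix = 1 := by
  ext v y
  have h : ∀ e, X.startMatrix v e * X.originMatrix e y =
      X.startMatrix v e * if v = y then 1 else 0 := fun e => by
    simp only [startMatrix, originMatrix, of_apply]
    by_cases hv : e.fst = v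
    · rw [hv]
    · rw [if_neg hv, zero_mul, zero_mul]
  rw [mul_apply, Finset.sum_congr rfl fun e _ => h e, ← Finset.sum_mul, sum_startMatrix, one_mul,
    one_apply]

/-- Consecutive edges share a vertex. This identifies deleting the last edge of a random path with
taking a path one step shorter. -/
theorem nbrwMatrix_mul_originMatrix (hk : 1 ≤ k) (hkK : k < K) :
    nbrwMatrix X.graph * X.originMatrix = X.endMatrix := by
  ext e y
  have h : ∀ f, nbrwMatrix X.graph e f * X.originMatrix f y =
      nbrwMatrix X.graph e f * X.endMatrix e y := fun f => by
    simp only [nbrwMatrix, originMatrix, endMatrix, of_apply]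
    by_cases hf : e.snd = f.fst ∧ f.snd ≠ e.fst
    · rw [← hf.1]
    · rw [if_neg hf, zero_mul, zero_mul]
  rw [mul_apply, Finset.sum_congr rfl fun f _ => h f, ← Finset.sum_mul,
    X.nbrwMatrix_row_sum hk hkK, one_mul]

theorem nbrwMatrix_mul_endMatrix_apply (e : X.graph.Dart) (y : X.L ⊕ X.R) :
    (nbrwMatrix X.graph * X.endMatrix) e y =
      if X.graph.Adj e.snd y ∧ y ≠ e.fst then ((X.graph.degree e.snd : ℝ) - 1)⁻¹ else 0 := by
  rw [mul_apply]
  have h : ∀ f : X.graph.Dart, nbrwMatrix X.graph e f * X.endMatrix f y =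
      if f.fst = e.snd then (fun x => (if x ≠ e.fst then ((X.graph.degree e.snd : ℝ) - 1)⁻¹ else 0)
        * if x = y then 1 else 0) f.snd else 0 := fun f => by
    simp only [nbrwMatrix, endMatrix, of_apply]
    by_cases h1 : f.fst = e.snd
    · simp [h1]
    · have h2 : e.snd ≠ f.fst := fun h => h1 h.symm
      simp [h1, h2]
  rw [Finset.sum_congr rfl fun f _ => h f, X.sum_dart_fst e.snd fun x =>
      (if x ≠ e.fst then ((X.graph.degree e.snd : ℝ) - 1)⁻¹ else 0) * if x = y then 1 else 0,
    Finset.sum_eq_single y]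
  · by_cases h1 : X.graph.Adj e.snd y <;> simp [h1]
  · intro b _ hb
    simp [hb]
  · simp

/-- A step of the simple walk from the end of a directed edge either backtracks or not. -/
theorem endMatrix_mul_srwMatrix_apply (hk : 1 ≤ k) (hkK : k < K) (e : X.graph.Dart)
    (y : X.L ⊕ X.R) :
    (X.endMatrix * srwMatrix X.graph) e y =
      (1 - backProb K k e.snd.isLeft) * (nbrwMatrix X.graph * X.endMatrix) e y +
        backProb K k e.snd.isLeft * X.originMatrix e y := by
  have hD : (2 : ℝ) ≤ X.graph.degree e.snd := by
    have := backProb_le_half hk hkK e.snd.isLeft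
    rw [← X.inv_degree, one_div] at this
    exact (inv_le_inv₀ (X.degree_pos _) two_pos).1 this
  rw [nbrwMatrix_mul_endMatrix_apply, ← X.inv_degree, mul_apply]
  simp only [endMatrix, originMatrix, srwMatrix, of_apply, ite_mul, one_mul, zero_mul,
    Finset.sum_ite_eq, Finset.mem_univ, if_true]
  by_cases h1 : y = e.fst
  · subst h1
    simp [e.adj.symm]
  · have h2 : e.fst ≠ y := fun h => h1 h.symm
    by_cases h3 : X.graph.Adj e.snd y
    · simp only [h1, h2, h3, ne_eq, not_false_eq_true, and_self, if_true, if_false, mul_zero,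
        add_zero]
      have : (X.graph.degree e.snd : ℝ) - 1 ≠ 0 := by linarith
      have := X.degree_pos e.snd
      field_simp
    · simp [h2, h3]

theorem startMatrix_mul_pow_ne_zero (d : ℕ) {v : X.L ⊕ X.R} {e : X.graph.Dart}
    (h : (X.startMatrix * nbrwMatrix X.graph ^ d) v e ≠ 0) :
    e.snd.isLeft = (not^[d + 1]) v.isLeft := by
  rw [mul_apply] at h
  obtain ⟨g, -, hg⟩ := Finset.exists_ne_zero_of_sum_ne_zero h
  have h1 := X.isLeft_of_nbrwMatrix_pow_ne_zero d (right_ne_zero_of_mul hg)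
  have h2 : g.fst = v := by
    by_contra hne
    exact left_ne_zero_of_mul hg (by simp [startMatrix, hne])
  rw [X.isLeft_of_adj e.adj, h1, h2, Function.iterate_succ_apply']

/-- Backtracking probability at a given distance, for paths from a given side. -/
noncomputable def backProbAt (K k : ℕ) (s : Bool) (d : ℕ) : ℝ := backProb K k ((not^[d]) s)

/-- A simple step from the end of a path of positive length either undoes its last edge, leaving a
uniform path one shorter, or extends it uniformly without backtracking. The probability of undoing
depends only on the side of the endpoint, hence on the starting side and the parity of the length.
-/
theorem pathMatrix_mul_srwMatrix_apply (hk : 1 ≤ k) (hkK : k < K) (d : ℕ) (v y : X.L ⊕ X.R) :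
    (X.pathMatrix d * srwMatrix X.graph) v y =
      distStep (backProbAt K k v.isLeft) (fun d => X.pathMatrix d v y) d := by
  cases d with
  | zero =>
    rw [distStep_zero, pathMatrix, pathMatrix, one_mul, pow_zero, Matrix.mul_one,
      startMatrix_mul_endMatrix]
  | succ d =>
    have h0 : X.startMatrix * nbrwMatrix X.graph ^ d * X.originMatrix = X.pathMatrix d := by
      cases d with
      | zero => rw [pow_zero, Matrix.mul_one, startMatrix_mul_originMatrix, pathMatrix]
      | succ d =>
        rw [pow_succ, ← Matrix.mul_assoc, Matrix.mul_assoc _ _ X.originMatrix,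
          X.nbrwMatrix_mul_originMatrix hk hkK, pathMatrix]
    have h1 : X.pathMatrix (d + 2) = X.startMatrix * nbrwMatrix X.graph ^ d *
        (nbrwMatrix X.graph * X.endMatrix) := by
      rw [pathMatrix, pow_succ, ← Matrix.mul_assoc, ← Matrix.mul_assoc]
    rw [distStep_succ, h1, ← h0, pathMatrix, Matrix.mul_assoc _ X.endMatrix,
      mul_apply, mul_apply, mul_apply (N := X.originMatrix), Finset.mul_sum, Finset.mul_sum,
      ← Finset.sum_add_distrib]
    refine Finset.sum_congr rfl fun e _ => ?_
    by_cases he : (X.startMatrix * nbrwMatrix X.graph ^ d) v e = 0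
    · rw [he]
      ring
    · rw [X.endMatrix_mul_srwMatrix_apply hk hkK, X.startMatrix_mul_pow_ne_zero d he, backProbAt]
      ring

/-- The simple random walk is a mixture of ends of non-backtracking paths, with lengths distributed
as the distance chain. -/
theorem srwMatrix_pow_apply (hk : 1 ≤ k) (hkK : k < K) (s : ℕ) (v y : X.L ⊕ X.R) :
    (srwMatrix X.graph ^ s) v y =
      (distStep (backProbAt K k v.isLeft) ^ s) (fun d => X.pathMatrix d v y) 0 := by
  -- The identity is proved from every initial length d; the walk itself starts at d = 0, where the
  -- path matrix is the identity.
  have h : ∀ s, (distStep (backProbAt K k v.isLeft) ^ s) (fun d => X.pathMatrix d v y) =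
      fun d => (X.pathMatrix d * srwMatrix X.graph ^ s) v y := by
    intro s
    induction s with
    | zero => simp
    | succ s ih =>
      rw [pow_succ', Module.End.mul_apply, ih]
      have h2 : (fun d => (X.pathMatrix d * srwMatrix X.graph ^ s) v y) =
          ∑ x, (srwMatrix X.graph ^ s) x y • fun d => X.pathMatrix d v x := by
        ext d
        simp [mul_apply, mul_comm]
      rw [h2, map_sum]
      ext d
      rw [pow_succ', ← Matrix.mul_assoc, mul_apply, Finset.sum_apply]
      refine Finset.sum_congr rfl fun x _ => ?_
      rw [map_smul, Pi.smul_apply, smul_eq_mul, ← X.pathMatrix_mul_srwMatrix_apply hk hkK, mul_comm]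
  rw [h]
  change _ = ((1 : Matrix (X.L ⊕ X.R) (X.L ⊕ X.R) ℝ) * srwMatrix X.graph ^ s) v y
  rw [one_mul]

theorem pathMatrix_entry (hk : 1 ≤ k) (hkK : k < K) (d : ℕ) (v y : X.L ⊕ X.R) :
    X.pathMatrix d v y = 0 ∨
      ((K : ℝ) + 1)⁻¹ * ((K : ℝ)⁻¹ * ((K : ℝ) * k)⁻¹ ^ (d / 2)) ≤ X.pathMatrix d v y := by
  have hk' : (1 : ℝ) ≤ k := by exact_mod_cast hk
  have hK' : (1 : ℝ) ≤ K := by exact_mod_cast (by omega : 1 ≤ K)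
  have hKk : (1 : ℝ) ≤ K * k := by nlinarith
  have hinv : (K : ℝ)⁻¹ ≤ 1 := inv_le_one_of_one_le₀ hK'
  have hinv1 : ((K : ℝ) + 1)⁻¹ ≤ 1 := inv_le_one_of_one_le₀ (by linarith)
  have hpow : ∀ j : ℕ, ((K : ℝ) * k)⁻¹ ^ j ≤ 1 := fun j =>
    pow_le_one₀ (by positivity) (inv_le_one_of_one_le₀ hKk)
  cases d with
  | zero =>
    rw [pathMatrix, one_apply]
    split_ifs
    · right
      exact mul_le_one₀ hinv1 (by positivity) (mul_le_one₀ hinv (by positivity) (hpow _))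
    · exact Or.inl rfl
  | succ d =>
    have h1 := Matrix.mul_entry_eq_zero_or_le (by positivity) (by positivity)
      (X.startMatrix_entry hkK) (X.nbrwMatrix_pow_entry hk hkK d)
    have h2 := Matrix.mul_entry_eq_zero_or_le (by positivity) zero_le_one h1 X.endMatrix_entry v y
    refine h2.imp_right fun h => le_trans ?_ h
    rw [mul_one]
    have : ((K : ℝ) * k)⁻¹ ^ ((d + 1) / 2) ≤ ((K : ℝ) * k)⁻¹ ^ (d / 2) :=
      pow_le_pow_of_le_one (by positivity) (inv_le_one_of_one_le₀ hKk) (by omega)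
    gcongr

theorem sum_pathMatrix (hk : 1 ≤ k) (hkK : k < K) (d : ℕ) (v : X.L ⊕ X.R) :
    ∑ y, X.pathMatrix d v y = 1 := by
  cases d with
  | zero => simp [pathMatrix, one_apply]
  | succ d =>
    exact Matrix.sum_row_mul (Matrix.sum_row_mul X.sum_startMatrix
      (Matrix.sum_row_pow (X.nbrwMatrix_row_sum hk hkK) d)) X.sum_endMatrix v

theorem srwMatrix_row_sum (v : X.L ⊕ X.R) : ∑ y, srwMatrix X.graph v y = 1 := by
  rw [← startMatrix_mul_endMatrix]
  exact Matrix.sum_row_mul X.sum_startMatrix X.sum_endMatrix v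

/-- The uniform distribution on the vertices of a given side. -/
noncomputable abbrev uniformSide (s : Bool) : X.L ⊕ X.R → ℝ :=
  uniformOn (Finset.univ.filter fun x : X.L ⊕ X.R => x.isLeft = s)

theorem card_side_mul_degree (x : X.L ⊕ X.R) :
    (Finset.univ.filter fun y : X.L ⊕ X.R => y.isLeft = x.isLeft).card * X.graph.degree x =
      X.edgeCard := by
  rw [edgeCard_eq, Finset.card_filter, Fintype.sum_sum_type]
  rcases x with l | r
  · rw [X.degree_left, card_edge_left]
    simp [leftCard]
  · rw [X.degree_right, card_edge_right]
    simp

theorem sum_uniformSide (s : Bool) : ∑ x, X.uniformSide s x = 1 := by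
  apply sum_uniformOn
  obtain ⟨p⟩ := (inferInstance : Nonempty X.Edge)
  cases s
  · exact ⟨Sum.inr p.1.2, by simp⟩
  · exact ⟨Sum.inl p.1.1, by simp⟩

/-- Each vertex x of the target side ends deg x darts, and deg x times the size of its side is N. -/
theorem sum_uniformDart_mul_endMatrix (s : Bool) (x : X.L ⊕ X.R) :
    ∑ e, X.uniformDart s e * X.endMatrix e x = X.uniformSide (!s) x := by
  have h : ∀ e : X.graph.Dart, X.uniformDart s e * X.endMatrix e x =
      if e.symm.fst = x then (if x.isLeft = (!s) then (X.edgeCard : ℝ)⁻¹ else 0) else 0 := by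
    intro e
    rw [uniformDart_apply, endMatrix, of_apply]
    change _ = if e.snd = x then _ else _
    by_cases hx : e.snd = x
    · subst hx
      rw [X.isLeft_of_adj e.adj, if_pos rfl, if_pos rfl, mul_one]
      exact if_congr ⟨fun h => by rw [h], fun h => Bool.not_inj h⟩ rfl rfl
    · rw [if_neg hx, if_neg hx, mul_zero]
  rw [Finset.sum_congr rfl fun e _ => h e]
  refine (Equiv.sum_comp (Function.Involutive.toPerm _
    (SimpleGraph.Dart.symm_involutive (G := X.graph))) (fun e : X.graph.Dart => if e.fst = x then
      (if x.isLeft = (!s) then (X.edgeCard : ℝ)⁻¹ else 0) else 0)).trans ?_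
  rw [X.sum_dart_fst x fun _ => if x.isLeft = (!s) then (X.edgeCard : ℝ)⁻¹ else 0, sum_ite_adj]
  simp only [uniformSide, uniformOn, Finset.mem_filter, Finset.mem_univ, true_and, mul_ite,
    mul_zero]
  split_ifs with hx
  · rw [← hx, ← card_side_mul_degree X x]
    push_cast
    have := (X.degree_pos x).ne'
    rw [_root_.mul_inv_rev, ← mul_assoc, mul_inv_cancel₀ this, one_mul]
  · rfl

theorem tvDist_pathMatrix_le {η : ℝ} {d : ℕ}
    (h : ∀ e, tvDist ((nbrwMatrix X.graph ^ d) e) (X.uniformDart ((not^[d]) e.fst.isLeft)) ≤ η)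
    (v : X.L ⊕ X.R) :
    tvDist (X.pathMatrix (d + 1) v) (X.uniformSide ((not^[d + 1]) v.isLeft)) ≤ η := by
  have := tvDist_mul_mul_le (w := X.startMatrix v) (X.startMatrix_nonneg v) (X.sum_startMatrix v)
    (M := nbrwMatrix X.graph ^ d) X.endMatrix_nonneg X.sum_endMatrix
    (ν := X.uniformDart ((not^[d]) v.isLeft)) (fun e he => by
      have h2 : e.fst = v := by
        by_contra hne
        exact he (by simp [startMatrix, hne])
      rw [← h2]
      exact h e)
  convert this using 2
  · ext x
    rw [pathMatrix, Matrix.mul_assoc, mul_apply]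
  · ext x
    rw [sum_uniformDart_mul_endMatrix, Function.iterate_succ_apply']

theorem abs_distStep_pow_le {ρ : ℕ → ℝ} (h0 : ∀ d, 0 ≤ ρ d) (h1 : ∀ d, ρ d ≤ 1) (s : ℕ)
    (g : ℕ → ℝ) (d : ℕ) : |(distStep ρ ^ s) g d| ≤ (distStep ρ ^ s) (fun d => |g d|) d := by
  rw [abs_le]
  constructor
  · have := distStep_pow_mono h0 h1 s (g := -fun d => |g d|) (g' := g)
      (fun d => neg_abs_le (g d)) d
    rwa [map_neg] at this
  · exact distStep_pow_mono h0 h1 s (fun d => le_abs_self (g d)) d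

theorem backProbAt_nonneg (s : Bool) (d : ℕ) : 0 ≤ backProbAt K k s d := backProb_nonneg _

theorem backProbAt_le_one (hk : 1 ≤ k) (hkK : k < K) (s : Bool) (d : ℕ) :
    backProbAt K k s d ≤ 1 := (backProb_le_half hk hkK _).trans (by norm_num)

/-- Convexity of total variation under the mixture over path lengths. The comparison law depends on
the parity of d, and at even times the mixture of these laws is the uniform law on the starting
side. -/
theorem tvDist_srw_le_distStep (hk : 1 ≤ k) (hkK : k < K) (m : ℕ) (v : X.L ⊕ X.R) :
    tvDist ((srwMatrix X.graph ^ (2 * m)) v) (X.uniformSide v.isLeft) ≤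
      (distStep (backProbAt K k v.isLeft) ^ (2 * m))
        (fun d => tvDist (X.pathMatrix d v) (X.uniformSide ((not^[d]) v.isLeft))) 0 := by
  -- Both neighbours of d have the opposite parity, so one step simply switches the side.
  have hU : ∀ (y : X.L ⊕ X.R) (s : ℕ), (distStep (backProbAt K k v.isLeft) ^ s)
      (fun d => X.uniformSide ((not^[d]) v.isLeft) y) =
        fun d => X.uniformSide ((not^[d + s]) v.isLeft) y := by
    intro y s
    induction s with
    | zero => rfl
    | succ s ih =>
      rw [pow_succ', Module.End.mul_apply, ih]
      ext (_ | d)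
      · rw [distStep_zero, add_comm]
        simp
      · rw [distStep_succ, show d + 2 + s = d + s + 2 by ring,
          show d + 1 + (s + 1) = d + s + 2 by ring]
        simp only [Function.iterate_succ_apply, Bool.not_not]
        ring
  have hsum : (fun d => tvDist (X.pathMatrix d v) (X.uniformSide ((not^[d]) v.isLeft))) =
      (1 / 2 : ℝ) • ∑ y, fun d => |X.pathMatrix d v y - X.uniformSide ((not^[d]) v.isLeft) y| := by
    ext d
    simp [tvDist]
  rw [hsum, map_smul, map_sum, Pi.smul_apply, Finset.sum_apply, smul_eq_mul, tvDist]
  refine mul_le_mul_of_nonneg_left (Finset.sum_le_sum fun y _ => ?_) (by norm_num)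
  refine le_trans (le_of_eq ?_) (abs_distStep_pow_le (backProbAt_nonneg _)
    (backProbAt_le_one hk hkK _) _ _ _)
  have : (fun d => X.pathMatrix d v y - X.uniformSide ((not^[d]) v.isLeft) y) =
      (fun d => X.pathMatrix d v y) - fun d => X.uniformSide ((not^[d]) v.isLeft) y := rfl
  rw [this, map_sub, Pi.sub_apply, hU, ← X.srwMatrix_pow_apply hk hkK]
  beta_reduce
  rw [zero_add, iterate_not_two_mul]

end Bigraph

theorem tvDist_le_one {α : Type*} [Fintype α] {μ ν : α → ℝ} (hμ : ∀ a, 0 ≤ μ a)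
    (hν : ∀ a, 0 ≤ ν a) (hμ1 : ∑ a, μ a = 1) (hν1 : ∑ a, ν a = 1) : tvDist μ ν ≤ 1 := by
  have h : ∑ a, |μ a - ν a| ≤ ∑ a, (μ a + ν a) := Finset.sum_le_sum fun a _ => by
    rw [abs_le]
    constructor <;> linarith [hμ a, hν a]
  rw [Finset.sum_add_distrib, hμ1, hν1] at h
  unfold tvDist
  linarith

theorem uniformOn_nonneg {α : Type*} [DecidableEq α] (S : Finset α) (a : α) :
    0 ≤ uniformOn S a := by
  unfold uniformOn
  split_ifs <;> positivity

/-! ### Two-sided bounds for the simple walk. -/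

namespace Bigraph

open Matrix

variable {K k : ℕ} (X : Bigraph.{u} K k)

theorem backProbAt_eq (s : Bool) (d : ℕ) :
    backProbAt K k s d = if Even d then backProb K k s else backProb K k (!s) := by
  rcases Nat.even_or_odd' d with ⟨j, rfl | rfl⟩
  · rw [backProbAt, iterate_not_two_mul, if_pos (even_two_mul j)]
  · rw [backProbAt, Function.iterate_succ_apply, iterate_not_two_mul,
      if_neg (Nat.not_even_two_mul_add_one j)]

/-- The speed of the simple random walk on the biregular tree. -/
noncomputable def speed (K k : ℕ) : ℝ := ((K : ℝ) * k - 1) / ((K + 1) * (k + 1))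

theorem one_sub_backProb_sub (s : Bool) :
    1 - backProb K k s - backProb K k (!s) = speed K k := by
  have h1 : (K : ℝ) + 1 ≠ 0 := by positivity
  have h2 : (k : ℝ) + 1 ≠ 0 := by positivity
  cases s <;> simp only [backProb, speed, Bool.not_true, Bool.not_false, cond_true, cond_false] <;>
    field_simp <;> ring

theorem distStep_backProbAt_pow_indicator_le (hk : 1 ≤ k) (hkK : k < K) (b : Bool) (s : ℕ)
    {B : ℕ → Prop} [DecidablePred B] {r : ℝ} (hr : 0 < r)
    (hB : ∀ d, B d → r + 1 ≤ |(d : ℝ) - speed K k * s|) :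
    (distStep (backProbAt K k b) ^ s) (fun d => if B d then 1 else 0) 0 ≤ 9 * s / r ^ 2 :=
  distStep_pow_indicator_le (backProb_nonneg b) (backProb_nonneg (!b))
    (backProb_le_half hk hkK _) (backProb_le_half hk hkK _) (backProbAt_eq b) s hr
    (by simpa only [one_sub_backProb_sub] using hB)

theorem pathMatrix_nonneg (hk : 1 ≤ k) (hkK : k < K) (d : ℕ) (v y : X.L ⊕ X.R) :
    0 ≤ X.pathMatrix d v y :=
  (X.pathMatrix_entry hk hkK d v y).elim (fun h => h.ge) fun h =>
    (by positivity : (0 : ℝ) ≤ _).trans h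

/-- The simple walk is mixed once the distance chain has passed the non-backtracking mixing time. -/
theorem tvDist_srw_le (hk : 1 ≤ k) (hkK : k < K) {D : ℕ} {η r : ℝ} (hr : 0 < r)
    (h : ∀ d, D ≤ d → ∀ e, tvDist ((nbrwMatrix X.graph ^ d) e)
      (X.uniformDart ((not^[d]) e.fst.isLeft)) ≤ η) (m : ℕ)
    (hD : D + r + 1 ≤ speed K k * (2 * m : ℕ)) (v : X.L ⊕ X.R) :
    tvDist ((srwMatrix X.graph ^ (2 * m)) v) (X.uniformSide v.isLeft) ≤
      η + 9 * (2 * m : ℕ) / r ^ 2 := by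
  classical
  obtain ⟨p⟩ := (inferInstance : Nonempty X.Edge)
  have hη : 0 ≤ η := (tvDist_nonneg _ _).trans (h D le_rfl (X.dartEquiv (Sum.inl p)))
  refine (X.tvDist_srw_le_distStep hk hkK m v).trans ?_
  have hB := distStep_backProbAt_pow_indicator_le hk hkK v.isLeft (2 * m) (B := fun d => d ≤ D) hr
    (fun d (hd : d ≤ D) => by
      have : (d : ℝ) ≤ D := by exact_mod_cast hd
      rw [abs_sub_comm]
      exact le_trans (by linarith) (le_abs_self _))
  -- Lengths up to D get the trivial bound 1 and are unlikely. A path with d > D edges is the walk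
  -- on darts at time d - 1 ≥ D, which explains why d = D counts as bad.
  refine (distStep_pow_mono (backProbAt_nonneg _) (backProbAt_le_one hk hkK _) (2 * m)
    (g' := (fun _ => η) + fun d => if d ≤ D then 1 else 0) (fun d => ?_) 0).trans ?_
  · rw [Pi.add_apply]
    by_cases hd : d ≤ D
    · rw [if_pos hd]
      have := tvDist_le_one (X.pathMatrix_nonneg hk hkK d v) (uniformOn_nonneg _)
        (X.sum_pathMatrix hk hkK d v) (X.sum_uniformSide ((not^[d]) v.isLeft))
      linarith
    · rw [if_neg hd, add_zero]
      obtain ⟨j, rfl⟩ : ∃ j, d = j + 1 := ⟨d - 1, by omega⟩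
      exact X.tvDist_pathMatrix_le (h j (by omega)) v
  · rw [map_add, Pi.add_apply, distStep_pow_const]
    linarith

theorem card_side (l : X.L) :
    (Finset.univ.filter fun x : X.L ⊕ X.R => x.isLeft = (Sum.inl l : X.L ⊕ X.R).isLeft).card =
      X.leftCard := by
  have h := X.card_side_mul_degree (Sum.inl l)
  rw [X.degree_left, edgeCard_eq_leftCard_mul] at h
  exact Nat.eq_of_mul_eq_mul_right (Nat.succ_pos K) h

/-- The simple walk is not mixed while the distance chain stays in a ball of small volume. -/
theorem le_tvDist_srw (hk : 1 ≤ k) (hkK : k < K) {D : ℕ} {r : ℝ} (hr : 0 < r) (m : ℕ)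
    (hD : speed K k * (2 * m : ℕ) + r ≤ D) (l : X.L) :
    1 - 9 * (2 * m : ℕ) / r ^ 2 -
        (D + 1) * ((K + 1) * K) * √(K * k) ^ D / X.leftCard ≤
      tvDist ((srwMatrix X.graph ^ (2 * m)) (Sum.inl l))
        (X.uniformSide (Sum.inl l : X.L ⊕ X.R).isLeft) := by
  classical
  have hk' : (1 : ℝ) ≤ k := by exact_mod_cast hk
  have hK' : (1 : ℝ) ≤ K := by exact_mod_cast (by omega : 1 ≤ K)
  have hKk : (1 : ℝ) ≤ K * k := by nlinarith
  set v : X.L ⊕ X.R := Sum.inl l with hv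
  set S : ℕ → Finset (X.L ⊕ X.R) := fun d => Finset.univ.filter fun x => X.pathMatrix d v x ≠ 0
    with hS
  -- A contains every endpoint of a non-backtracking path of length at most D from v, so it carries
  -- the walk as long as the distance chain stays at most D.
  set A := (Finset.range (D + 1)).biUnion S with hA
  have hScard : ∀ d ∈ Finset.range (D + 1), ((S d).card : ℝ) ≤ (K + 1) * K * √(K * k) ^ D := by
    intro d hd
    rw [Finset.mem_range] at hd
    have h1 := card_support_le (X.sum_pathMatrix hk hkK d v) (by positivity)
      (X.pathMatrix_entry hk hkK d v) (S d) (fun x hx => (Finset.mem_filter.1 hx).2)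
    refine h1.trans ?_
    rw [_root_.mul_inv_rev, _root_.mul_inv_rev, ← inv_pow, inv_inv, inv_inv, inv_inv]
    have h2 : ((K : ℝ) * k) ^ (d / 2) ≤ √(K * k) ^ D := by
      calc ((K : ℝ) * k) ^ (d / 2) = √(K * k) ^ (2 * (d / 2)) := by
            rw [pow_mul, Real.sq_sqrt (by positivity)]
        _ ≤ _ := pow_le_pow_right₀ (Real.one_le_sqrt.2 hKk) (by omega)
    calc ((K : ℝ) * k) ^ (d / 2) * K * (K + 1) ≤ √(K * k) ^ D * K * (K + 1) := by gcongr
      _ = _ := by ring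
  have hAcard : (A.card : ℝ) ≤ (D + 1) * ((K + 1) * K) * √(K * k) ^ D := by
    calc (A.card : ℝ) ≤ ∑ d ∈ Finset.range (D + 1), ((S d).card : ℝ) := by
          exact_mod_cast Finset.card_biUnion_le
      _ ≤ (Finset.range (D + 1)).card • ((K + 1) * K * √(K * k) ^ D) :=
          Finset.sum_le_card_nsmul _ _ _ hScard
      _ = _ := by
          rw [Finset.card_range, nsmul_eq_mul]
          push_cast
          ring
  have hB := distStep_backProbAt_pow_indicator_le hk hkK v.isLeft (2 * m) (B := fun d => D < d) hr
    (fun d (hd : D < d) => by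
      have : (D : ℝ) + 1 ≤ d := by exact_mod_cast hd
      exact le_trans (by linarith) (le_abs_self _))
  have hmass : 1 - 9 * (2 * m : ℕ) / r ^ 2 ≤ ∑ y ∈ A, (srwMatrix X.graph ^ (2 * m)) v y := by
    have h1 : ∑ y ∈ A, (srwMatrix X.graph ^ (2 * m)) v y =
        (distStep (backProbAt K k v.isLeft) ^ (2 * m))
          (∑ y ∈ A, fun d => X.pathMatrix d v y) 0 := by
      rw [map_sum, Finset.sum_apply]
      exact Finset.sum_congr rfl fun y _ => X.srwMatrix_pow_apply hk hkK _ _ _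
    rw [h1]
    refine le_trans ?_ (distStep_pow_mono (backProbAt_nonneg _) (backProbAt_le_one hk hkK _)
      (2 * m) (g := (fun _ => 1) - fun d => if D < d then 1 else 0) (fun d => ?_) 0)
    · rw [map_sub, Pi.sub_apply, distStep_pow_const]
      linarith
    · rw [Pi.sub_apply, Finset.sum_apply]
      by_cases hd : D < d
      · rw [if_pos hd, sub_self]
        exact Finset.sum_nonneg fun y _ => X.pathMatrix_nonneg hk hkK d v y
      · rw [if_neg hd, sub_zero, ← X.sum_pathMatrix hk hkK d v]
        refine (Finset.sum_subset (Finset.subset_univ A) fun y _ hy => ?_).ge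
        by_contra hne
        exact hy (Finset.mem_biUnion.2 ⟨d, Finset.mem_range.2 (by omega),
          Finset.mem_filter.2 ⟨Finset.mem_univ _, hne⟩⟩)
  have h3 := sum_sub_sum_le_tvDist ((Matrix.sum_row_pow X.srwMatrix_row_sum (2 * m) v).trans
    (X.sum_uniformSide v.isLeft).symm) A
  have h4 := sum_uniformOn_le (Finset.univ.filter fun x : X.L ⊕ X.R => x.isLeft = v.isLeft) A
  rw [hv, card_side, ← hv, ← div_eq_mul_inv] at h4
  have h5 : (A.card : ℝ) / X.leftCard ≤
      (D + 1) * ((K + 1) * K) * √(K * k) ^ D / X.leftCard := by gcongr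
  change _ - ∑ x ∈ A, uniformOn _ x ≤ _ at h3
  linarith

/-- A bound for the non-backtracking walk valid at all times past `D`. -/
theorem tvDist_nbrw_le_of_le (hX : X.IsRamanujan) (hk : 1 ≤ k) (hkK : k < K) {D d : ℕ}
    (hd : D ≤ d) (e : X.graph.Dart) :
    tvDist ((nbrwMatrix X.graph ^ d) e) (X.uniformDart ((not^[d]) e.fst.isLeft)) ≤
      √X.edgeCard * ((√(K * k) + 1) * ((D / 2 : ℕ) + 1) * (√(K * k))⁻¹ ^ (D / 2)) *
        (√(K * k) / (√(K * k) - 1)) := by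
  have hKk : (1 : ℝ) < K * k := by
    have : 1 < K * k := by nlinarith
    exact_mod_cast this
  set q := √((K : ℝ) * k) with hq
  have hq1 : 1 < q := Real.lt_sqrt_of_sq_lt (by simpa using hKk)
  have hq0 : 0 < q := by linarith
  refine (X.tvDist_nbrw_le hX hk hkK d e).trans ?_
  rw [← hq]
  obtain ⟨i, hi⟩ : ∃ i, d / 2 = D / 2 + i := ⟨d / 2 - D / 2, by omega⟩
  set j := D / 2
  rw [hi]
  -- Bernoulli's inequality for q^(i+1). The bound (j+1)q^(-j) need not be monotone in j, and
  -- q/(q-1) is a uniform price for letting time run on.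
  have h1 : ((i : ℝ) + 1) * q⁻¹ ^ i ≤ q / (q - 1) := by
    have := one_add_mul_le_pow (by linarith : -2 ≤ q - 1) (i + 1)
    rw [add_sub_cancel, pow_succ] at this
    push_cast at this
    rw [inv_pow, ← div_eq_mul_inv, div_le_div_iff₀ (by positivity) (by linarith)]
    linarith
  have h2 : (((j + i : ℕ) : ℝ) + 1) ≤ (j + 1) * (i + 1) := by
    push_cast
    have : (0 : ℝ) ≤ j * i := by positivity
    linarith
  calc √X.edgeCard * ((q + 1) * (((j + i : ℕ) : ℝ) + 1) * q⁻¹ ^ (j + i))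
      ≤ √X.edgeCard * ((q + 1) * ((j + 1) * (i + 1)) * q⁻¹ ^ (j + i)) := by gcongr
    _ = √X.edgeCard * ((q + 1) * (j + 1) * q⁻¹ ^ j) * ((i + 1) * q⁻¹ ^ i) := by ring
    _ ≤ _ := by gcongr

end Bigraph

/-! ### From distance bounds to cutoff. -/

/-- The witness in `hup` also makes the set of mixing times nonempty, so its infimum is attained
rather than being the default value 0. The lower bound is then tested at that time only, so no
monotonicity of the distance is needed. -/
theorem abs_evenMixingTime_sub_le {α : Type*} [Fintype α] [DecidableEq α] {P : Matrix α α ℝ}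
    {side : α → Bool} {ε t w : ℝ}
    (hup : ∃ m : ℕ, ((2 * m : ℕ) : ℝ) ≤ t + w ∧
      ∀ a₀, tvDist ((P ^ (2 * m)) a₀) (uniformOn {a | side a = side a₀}) < ε)
    (hlow : ∀ m : ℕ, ((2 * m : ℕ) : ℝ) < t - w →
      ∃ a₀, ε ≤ tvDist ((P ^ (2 * m)) a₀) (uniformOn {a | side a = side a₀})) :
    |(evenMixingTime P side ε : ℝ) - t| ≤ w := by
  obtain ⟨m, hm, hmix⟩ := hup
  have hmem : 2 * m ∈ {s : ℕ | Even s ∧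
      ∀ a₀ : α, tvDist ((P ^ s) a₀) (uniformOn {a | side a = side a₀}) < ε} :=
    ⟨even_two_mul m, hmix⟩
  have h1 : evenMixingTime P side ε ≤ 2 * m := Nat.sInf_le hmem
  have h1' : (evenMixingTime P side ε : ℝ) ≤ (2 * m : ℕ) := by exact_mod_cast h1
  obtain ⟨⟨j, hj⟩, h3⟩ := Nat.sInf_mem ⟨_, hmem⟩
  have h2 : evenMixingTime P side ε = 2 * j := by rw [evenMixingTime, hj, two_mul]
  rw [hj, ← two_mul] at h3
  rw [abs_le]
  refine ⟨?_, by linarith⟩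
  by_contra! h
  obtain ⟨a₀, ha⟩ := hlow j (by rw [← h2]; linarith)
  exact (h3 a₀).not_ge ha

/-- Both mixing times are asymptotically equivalent to t, and t is eventually nonzero because it
tends to infinity. -/
theorem exhibitsCutoff_of_cutoffAt {ι : Type*} {l : Filter ι} {tmix : ℝ → ι → ℕ} {t : ι → ℝ}
    {w : ℝ → ι → ℝ} (ht : Tendsto t l atTop) (h : CutoffAt l tmix t w) :
    ExhibitsCutoff l tmix := by
  have key : ∀ ε : ℝ, 0 < ε → ε < 1 → (fun i => (tmix ε i : ℝ)) ~[l] t := by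
    intro ε h0 h1
    obtain ⟨hw, hb⟩ := h ε h0 h1
    refine IsBigO.trans_isLittleO (IsBigO.of_bound 1 ?_) hw
    filter_upwards [hb] with i hi
    rw [one_mul, Real.norm_eq_abs, Real.norm_eq_abs]
    exact hi.trans (le_abs_self _)
  intro ε h0 h1
  have h2 := (key ε h0 h1).div (key (1 - ε) (by linarith) (by linarith))
  have h3 : (fun i => t i / t i) =ᶠ[l] fun _ => (1 : ℝ) := by
    filter_upwards [ht.eventually_gt_atTop 0] with i hi
    exact div_self hi.ne'
  exact (isEquivalent_const_iff_tendsto one_ne_zero).1 (h2.trans h3.isEquivalent)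

theorem Real.sqrt_mul_natCast_gt_one {K k : ℕ} (hk : 1 ≤ k) (hkK : k < K) :
    1 < √((K : ℝ) * k) := by
  have : (1 : ℝ) < K * k := by
    have : 1 < K * k := by nlinarith
    exact_mod_cast this
  exact Real.lt_sqrt_of_sq_lt (by simpa using this)

theorem tendsto_edgeCard (K k : ℕ) :
    Tendsto (fun X : RamanujanBigraph.{u} K k => (X.1.edgeCard : ℝ)) (largeGraphs K k) atTop :=
  tendsto_natCast_atTop_atTop.comp tendsto_comap

theorem tendsto_leftCard (K k : ℕ) :
    Tendsto (fun X : RamanujanBigraph.{u} K k => (X.1.leftCard : ℝ)) (largeGraphs K k) atTop := by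
  have h := (tendsto_edgeCard.{u} K k).atTop_mul_const (by positivity : (0 : ℝ) < ((K : ℝ) + 1)⁻¹)
  refine h.congr fun X => ?_
  rw [X.1.edgeCard_eq_leftCard_mul]
  push_cast
  field_simp

/-- With y = log_b N the window satisfies q^w = y³. At time about t + w the upper bound √N · m ·
q^(-m) is of order y · y^(-3/2) = y^(-1/2); the coefficient 3 beats the linear factor m. Before t -
w the support fills a proportion at most y^(-3). -/
theorem nbrw_cutoffAt {K k : ℕ} (hk : 1 ≤ k) (hkK : k < K) {b : ℝ} (hb : 1 < b) :
    CutoffAt (largeGraphs.{u} K k) (fun ε X => X.1.nbrwMixingTime ε)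
      (fun X => Real.logb (√(K * k)) X.1.edgeCard)
      (fun _ X => 3 * Real.logb (√(K * k)) (Real.logb b X.1.edgeCard)) := by
  intro ε hε0 hε1
  have hq1 := Real.sqrt_mul_natCast_gt_one hk hkK
  have hqsq : √((K : ℝ) * k) ^ 2 = K * k := Real.sq_sqrt (by positivity)
  set q := √((K : ℝ) * k) with hq
  have hq0 : 0 < q := by linarith
  have hΛ : 0 < Real.log q := Real.log_pos hq1
  have hlb : 0 < Real.log b := Real.log_pos hb
  have hY : Tendsto (fun X : RamanujanBigraph.{u} K k => Real.logb b X.1.edgeCard)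
      (largeGraphs K k) atTop := (Real.tendsto_logb_atTop hb).comp (tendsto_edgeCard K k)
  have ht : ∀ X : RamanujanBigraph.{u} K k, Real.logb q X.1.edgeCard =
      (Real.log b / Real.log q) * Real.logb b X.1.edgeCard := fun X => by
    rw [Real.logb, Real.logb]
    field_simp
  constructor
  · have h1 := Real.isLittleO_log_id_atTop.comp_tendsto hY
    have h2 : (fun X : RamanujanBigraph.{u} K k => 3 * Real.logb q (Real.logb b X.1.edgeCard)) =
        fun X => (3 / Real.log q) * (Real.log ∘ fun X : RamanujanBigraph.{u} K k =>
          Real.logb b X.1.edgeCard) X := by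
      ext X
      simp only [Real.logb, Function.comp]
      ring
    rw [h2, funext ht]
    exact (h1.const_mul_left _).const_mul_right (by positivity)
  · set A : ℝ := (q + 1) * (((Real.log b + 3) / (2 * Real.log q) + 1) * q) with hA
    have hev1 : ∀ᶠ y : ℝ in atTop, A / √y < ε :=
      (tendsto_const_nhds.div_atTop Real.tendsto_sqrt_atTop).eventually_lt_const hε0
    have hev2 : ∀ᶠ y : ℝ in atTop, (y ^ 3)⁻¹ < 1 - ε :=
      ((tendsto_pow_atTop (by norm_num : (3 : ℕ) ≠ 0)).inv_tendsto_atTop).eventually_lt_const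
        (by linarith)
    filter_upwards [hY.eventually hev1, hY.eventually hev2, hY.eventually (eventually_ge_atTop 1)]
      with X h1 h2 h3
    have hN : (0 : ℝ) < X.1.edgeCard := by exact_mod_cast X.1.edgeCard_pos
    have htX := ht X
    set N : ℝ := (X.1.edgeCard : ℝ) with hNdef
    set y := Real.logb b N
    set t := Real.logb q N with htdef
    set w := 3 * Real.logb q y with hw
    have hy0 : 0 < y := by linarith
    have ht0 : 0 ≤ t := by rw [htX]; positivity
    have hw0 : 0 ≤ w := by
      have := Real.logb_nonneg hq1 h3
      positivity
    have hqt : q ^ t = N := Real.rpow_logb hq0 hq1.ne' hN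
    have hqw : q ^ w = y ^ 3 := by
      rw [hw, mul_comm, Real.rpow_mul hq0.le, Real.rpow_logb hq0 hq1.ne' hy0]
      norm_cast
    apply abs_evenMixingTime_sub_le
    · set m := ⌊(t + w) / 2⌋₊ with hm
      have hm1 : (m : ℝ) ≤ (t + w) / 2 := Nat.floor_le (by positivity)
      have hm2 : (t + w) / 2 - 1 ≤ m := (Nat.sub_one_lt_floor _).le
      refine ⟨m, by push_cast; linarith, fun e => ?_⟩
      refine (X.1.tvDist_nbrw_even_le X.2 hk hkK m e).trans_lt (lt_of_le_of_lt ?_ h1)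
      rw [← hq, ← hNdef]
      -- The factor q is the loss from rounding m down.
      have e1 : q⁻¹ ^ m ≤ q / (√N * √(y ^ 3)) := by
        have e2 : √N * √(y ^ 3) = q ^ ((t + w) / 2) := by
          rw [← Real.sqrt_mul hN.le, ← hqt, ← hqw, ← Real.rpow_add hq0, Real.sqrt_eq_rpow,
            ← Real.rpow_mul hq0.le]
          congr 1
          ring
        rw [e2, inv_pow, ← Real.rpow_natCast, ← Real.rpow_neg hq0.le, div_eq_mul_inv,
          ← Real.rpow_neg hq0.le]
        nth_rewrite 2 [← Real.rpow_one q]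
        rw [← Real.rpow_add hq0]
        exact Real.rpow_le_rpow_of_exponent_le hq1.le (by linarith)
      have e3 : (m : ℝ) + 1 ≤ ((Real.log b + 3) / (2 * Real.log q) + 1) * y := by
        have e4 : w ≤ 3 * (y / Real.log q) := by
          rw [hw, Real.logb]
          gcongr
          exact (Real.log_le_sub_one_of_pos hy0).trans (by linarith)
        have e5 : ((Real.log b + 3) / (2 * Real.log q) + 1) * y =
            (Real.log b / Real.log q * y + 3 * (y / Real.log q)) / 2 + y := by
          field_simp
        rw [e5, ← htX]
        linarith
      have e6 : √(y ^ 3) = y * √y := by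
        rw [pow_succ, Real.sqrt_mul (by positivity), Real.sqrt_sq hy0.le]
      have hsN : 0 < √N := Real.sqrt_pos.2 hN
      have hsy : 0 < √y := Real.sqrt_pos.2 hy0
      calc √N * ((q + 1) * (m + 1) * q⁻¹ ^ m)
          ≤ √N * ((q + 1) * (((Real.log b + 3) / (2 * Real.log q) + 1) * y) *
              (q / (√N * √(y ^ 3)))) := by gcongr
        _ = A / √y := by
            rw [e6, hA]
            field_simp
    · intro m hm
      refine ⟨X.1.dartEquiv (Sum.inl (Classical.arbitrary X.1.Edge)), ?_⟩
      refine le_trans ?_ (X.1.le_tvDist_nbrw hk hkK m _)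
      have e1 : ((K : ℝ) * k) ^ m ≤ N * (y ^ 3)⁻¹ := by
        rw [← hqsq, ← pow_mul, ← hqt, ← hqw, ← Real.rpow_neg hq0.le, ← Real.rpow_add hq0,
          ← Real.rpow_natCast]
        exact Real.rpow_le_rpow_of_exponent_le hq1.le (by linarith)
      have e2 : ((K : ℝ) * k) ^ m / N ≤ (y ^ 3)⁻¹ := by
        rwa [div_le_iff₀ hN, mul_comm _ N]
      linarith

theorem speed_pos {K k : ℕ} (hk : 1 ≤ k) (hkK : k < K) : 0 < Bigraph.speed K k := by
  have : (1 : ℝ) < K * k := by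
    have : 1 < K * k := by nlinarith
    exact_mod_cast this
  exact div_pos (by linarith) (by positivity)

set_option maxHeartbeats 1000000 in
theorem srw_cutoffAt {K k : ℕ} (hk : 1 ≤ k) (hkK : k < K) :
    ∃ c : ℝ → ℝ, CutoffAt (largeGraphs.{u} K k) (fun ε X => X.1.srwMixingTime ε)
      (fun X => ((K + 1 : ℝ) * (k + 1)) / (K * k - 1) * Real.logb (√(K * k)) X.1.leftCard)
      (fun ε X => c ε * √(Real.log X.1.leftCard)) := by
  have hq1 := Real.sqrt_mul_natCast_gt_one hk hkK
  have hν := speed_pos hk hkK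
  have hinv : ((K + 1 : ℝ) * (k + 1)) / (K * k - 1) = (Bigraph.speed K k)⁻¹ := by
    rw [Bigraph.speed, inv_div]
  rw [hinv]
  set q := √((K : ℝ) * k) with hq
  set ν := Bigraph.speed K k with hνdef
  have hq0 : 0 < q := by linarith
  have hΛ : 0 < Real.log q := Real.log_pos hq1
  set Λ := Real.log q with hΛdef
  set κ := (ν * Λ)⁻¹ with hκ
  have hκ0 : 0 < κ := by positivity
  have hU : Tendsto (fun X : RamanujanBigraph.{u} K k => √(Real.log X.1.leftCard))
      (largeGraphs K k) atTop :=
    Real.tendsto_sqrt_atTop.comp (Real.tendsto_log_atTop.comp (tendsto_leftCard K k))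
  -- With u = √(log n), t = κu² and deviation a·u, Chebyshev at times up to 2t gives 18κ/a². The
  -- choice of a makes this ε(1-ε)/2, at most half of both ε and 1 - ε. The added 2 leaves one u to
  -- separate D from log_q n and one u for rounding.
  refine ⟨fun ε => (√(36 * κ / (ε * (1 - ε))) + 2) / ν, fun ε hε0 hε1 => ?_⟩
  have hεε : 0 < ε * (1 - ε) := mul_pos hε0 (by linarith)
  have hεε₁ : ε * (1 - ε) / 2 ≤ ε / 2 := by nlinarith
  have hεε₂ : ε * (1 - ε) / 2 ≤ (1 - ε) / 2 := by nlinarith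
  have ha : 18 * κ / √(36 * κ / (ε * (1 - ε))) ^ 2 = ε * (1 - ε) / 2 := by
    rw [Real.sq_sqrt (by positivity)]
    field_simp
    ring
  have ha0 : 0 < √(36 * κ / (ε * (1 - ε))) := Real.sqrt_pos.2 (by positivity)
  set a := √(36 * κ / (ε * (1 - ε)))
  set C := (a + 2) / ν with hC
  have hC0 : 0 < C := by positivity
  have hνC : ν * C = a + 2 := by rw [hC]; field_simp
  have hlogX : ∀ X : RamanujanBigraph.{u} K k, ν⁻¹ * Real.logb q X.1.leftCard =
      κ * √(Real.log X.1.leftCard) ^ 2 := fun X => by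
    rw [Real.sq_sqrt (Real.log_natCast_nonneg _), Real.logb, hκ, mul_inv, mul_assoc,
      div_eq_inv_mul]
  constructor
  · rw [funext hlogX]
    have h1 : (fun u : ℝ => u) =o[atTop] fun u => u ^ 2 := by
      simpa using isLittleO_pow_pow_atTop_of_lt (𝕜 := ℝ) one_lt_two
    exact ((h1.comp_tendsto hU).const_mul_left _).const_mul_right hκ0.ne'
  · set c₁ : ℝ := √(K + 1) * ((q + 1) * (1 / Λ + 3) * Real.exp (Λ / 2)) * (q / (q - 1)) with hc₁
    set c₂ : ℝ := (1 / Λ + 1) * ((K + 1) * K) with hc₂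
    have hlim : Tendsto (fun u : ℝ => u ^ 2 * Real.exp (-(Λ / 2) * u)) atTop (𝓝 0) := by
      have := tendsto_rpow_mul_exp_neg_mul_atTop_nhds_zero 2 (Λ / 2) (by positivity)
      simpa using this
    have hev1 : ∀ᶠ u : ℝ in atTop, c₁ * (u ^ 2 * Real.exp (-(Λ / 2) * u)) < ε / 2 := by
      have := hlim.const_mul c₁
      rw [mul_zero] at this
      exact this.eventually_lt_const (by linarith)
    have hev2 : ∀ᶠ u : ℝ in atTop, c₂ * (u ^ 2 * Real.exp (-(Λ / 2) * u)) < (1 - ε) / 2 := by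
      have := hlim.const_mul c₂
      rw [mul_zero] at this
      exact this.eventually_lt_const (by linarith)
    -- The last three conditions absorb the rounding errors, make C·u ≤ t so that the times
    -- considered are at most 2t, and ensure u ≤ log_q n.
    filter_upwards [hU.eventually hev1, hU.eventually hev2,
      hU.eventually (eventually_ge_atTop (2 + 2 * ν)), hU.eventually (eventually_ge_atTop (C / κ)),
      hU.eventually (eventually_ge_atTop Λ)] with X h1 h2 h3 h4 h5
    rw [hlogX X]
    have hn : (0 : ℝ) < X.1.leftCard := by exact_mod_cast X.1.leftCard_pos
    have hnexp : (X.1.leftCard : ℝ) = Real.exp (√(Real.log X.1.leftCard) ^ 2) := by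
      rw [Real.sq_sqrt (Real.log_natCast_nonneg _), Real.exp_log hn]
    have hedge : (X.1.edgeCard : ℝ) = (K + 1) * X.1.leftCard := by
      rw [X.1.edgeCard_eq_leftCard_mul]
      push_cast
      ring
    set n : ℝ := (X.1.leftCard : ℝ)
    set u := √(Real.log n) with hu
    have hu2 : 2 ≤ u := by linarith
    have hqexp : ∀ j : ℕ, q ^ j = Real.exp (Λ * j) := fun j => by
      rw [hΛdef, ← Real.rpow_natCast, Real.rpow_def_of_pos hq0]
    set ℓ := u ^ 2 / Λ with hℓ
    have hℓ0 : 0 ≤ ℓ := by positivity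
    have hℓΛ : Λ * ℓ = u ^ 2 := by rw [hℓ]; field_simp
    have hνt : ν * (κ * u ^ 2) = ℓ := by rw [hκ, hℓ]; field_simp
    have hlu : u ≤ ℓ := by
      rw [hℓ, le_div_iff₀ hΛ, sq]
      gcongr
    have hu3 : 2 * u ≤ u ^ 2 := by
      rw [sq]
      gcongr
    have hCκ : C * u ≤ κ * u ^ 2 := by
      rw [div_le_iff₀ hκ0] at h4
      calc C * u ≤ u * κ * u := by gcongr
        _ = κ * u ^ 2 := by ring
    apply abs_evenMixingTime_sub_le
    · set m := ⌊(κ * u ^ 2 + C * u) / 2⌋₊ with hm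
      have hm1 : (m : ℝ) ≤ (κ * u ^ 2 + C * u) / 2 := Nat.floor_le (by positivity)
      have hm2 : (κ * u ^ 2 + C * u) / 2 - 1 ≤ m := (Nat.sub_one_lt_floor _).le
      refine ⟨m, by push_cast; linarith, fun v => ?_⟩
      -- Here ℓ = log_q n. A margin of u past ℓ gains a factor exp(-Λu/2), which kills the
      -- polynomial factor in u.
      set D := ⌈ℓ + u⌉₊ with hD
      have hD1 : ℓ + u ≤ D := Nat.le_ceil _
      have hD2 : (D : ℝ) ≤ ℓ + u + 1 := (Nat.ceil_lt_add_one (by positivity)).le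
      have key := X.1.tvDist_srw_le hk hkK (D := D) (r := a * u) (by positivity)
        (fun d hd e => X.1.tvDist_nbrw_le_of_le X.2 hk hkK hd e) m (by
          rw [← hνdef]
          have e1 : ν * (κ * u ^ 2 + C * u - 2) ≤ ν * (2 * m : ℕ) := by
            apply mul_le_mul_of_nonneg_left _ hν.le
            push_cast
            linarith
          have e2 : ν * (κ * u ^ 2 + C * u - 2) = ℓ + (a + 2) * u - 2 * ν := by
            rw [← hνt, ← hνC]
            ring
          linarith) v
      refine key.trans_lt ?_
      rw [← hq, hedge]
      set J := D / 2 with hJ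
      have hJ1 : (J : ℝ) ≤ D / 2 := Nat.cast_div_le
      have hJ2 : ((D : ℝ) - 1) / 2 ≤ J := by
        have : D ≤ 2 * J + 1 := by omega
        have : (D : ℝ) ≤ 2 * J + 1 := by exact_mod_cast this
        linarith
      have e1 : q⁻¹ ^ J ≤ Real.exp (-(u ^ 2 / 2)) * Real.exp (-(Λ / 2) * u) *
          Real.exp (Λ / 2) := by
        rw [inv_pow, hqexp, ← Real.exp_neg, ← Real.exp_add, ← Real.exp_add, Real.exp_le_exp]
        have : Λ * ((ℓ + u - 1) / 2) ≤ Λ * J := by gcongr; linarith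
        linarith
      have e2 : √((K + 1) * n) = √(K + 1) * Real.exp (u ^ 2 / 2) := by
        rw [Real.sqrt_mul (by positivity), hnexp, Real.sqrt_eq_rpow (Real.exp _), ← Real.exp_mul]
        congr 2
        ring
      have e3 : (J : ℝ) + 1 ≤ (1 / Λ + 3) * u ^ 2 := by
        have : (1 / Λ + 3) * u ^ 2 = ℓ + 3 * u ^ 2 := by rw [hℓ]; ring
        rw [this]
        linarith
      have e4 : √((K + 1) * n) * ((q + 1) * (J + 1) * q⁻¹ ^ J) * (q / (q - 1)) ≤
          c₁ * (u ^ 2 * Real.exp (-(Λ / 2) * u)) := by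
        have hq2 : 0 ≤ q / (q - 1) := div_nonneg hq0.le (by linarith)
        calc _ ≤ √(K + 1) * Real.exp (u ^ 2 / 2) * ((q + 1) * ((1 / Λ + 3) * u ^ 2) *
              (Real.exp (-(u ^ 2 / 2)) * Real.exp (-(Λ / 2) * u) * Real.exp (Λ / 2))) *
              (q / (q - 1)) := by
              rw [e2]
              gcongr
          _ = c₁ * (u ^ 2 * Real.exp (-(Λ / 2) * u)) *
              (Real.exp (u ^ 2 / 2) * Real.exp (-(u ^ 2 / 2))) := by
              rw [hc₁]
              ring
          _ = _ := by rw [← Real.exp_add, add_neg_cancel, Real.exp_zero, mul_one]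
      have e5 : 9 * ((2 * m : ℕ) : ℝ) / (a * u) ^ 2 ≤ ε / 2 := by
        have : 9 * ((2 * m : ℕ) : ℝ) ≤ 18 * κ * u ^ 2 := by
          push_cast
          linarith
        calc 9 * ((2 * m : ℕ) : ℝ) / (a * u) ^ 2 ≤ 18 * κ * u ^ 2 / (a * u) ^ 2 := by gcongr
          _ = 18 * κ / a ^ 2 := by field_simp
          _ ≤ ε / 2 := ha.trans_le hεε₁
      linarith
    · intro m hm
      obtain ⟨p⟩ := (inferInstance : Nonempty X.1.Edge)
      refine ⟨Sum.inl p.1.1, ?_⟩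
      -- A ball of radius ℓ - u has O(u² n exp(-Λu)) vertices, a vanishing proportion of n.
      set D := ⌊ℓ - u⌋₊ with hD
      have hD1 : (D : ℝ) ≤ ℓ - u := Nat.floor_le (by linarith)
      have hD2 : ℓ - u - 1 ≤ D := (Nat.sub_one_lt_floor _).le
      refine le_trans ?_ (X.1.le_tvDist_srw hk hkK (D := D) (r := a * u) (by positivity) m ?_ p.1.1)
      · rw [← hq]
        have e1 : q ^ D ≤ n * Real.exp (-(Λ / 2) * u) := by
          rw [hqexp, hnexp, ← Real.exp_add, Real.exp_le_exp]
          have h6 : Λ * D ≤ Λ * (ℓ - u) := by gcongr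
          have h7 : 0 ≤ Λ * u := by positivity
          rw [mul_sub, hℓΛ] at h6
          linarith
        have e2 : (D : ℝ) + 1 ≤ (1 / Λ + 1) * u ^ 2 := by
          have : (1 / Λ + 1) * u ^ 2 = ℓ + u ^ 2 := by rw [hℓ]; ring
          rw [this]
          linarith
        have e3 : ((D : ℝ) + 1) * ((K + 1) * K) * q ^ D / n ≤
            c₂ * (u ^ 2 * Real.exp (-(Λ / 2) * u)) := by
          rw [div_le_iff₀ hn]
          calc ((D : ℝ) + 1) * ((K + 1) * K) * q ^ D
              ≤ ((1 / Λ + 1) * u ^ 2) * ((K + 1) * K) * (n * Real.exp (-(Λ / 2) * u)) := by gcongr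
            _ = _ := by rw [hc₂]; ring
        have e5 : 9 * ((2 * m : ℕ) : ℝ) / (a * u) ^ 2 ≤ (1 - ε) / 2 := by
          have : 9 * ((2 * m : ℕ) : ℝ) ≤ 18 * κ * u ^ 2 := by
            have : 0 ≤ C * u := by positivity
            have : 0 ≤ κ * u ^ 2 := by positivity
            linarith
          calc 9 * ((2 * m : ℕ) : ℝ) / (a * u) ^ 2 ≤ 18 * κ * u ^ 2 / (a * u) ^ 2 := by gcongr
            _ = 18 * κ / a ^ 2 := by field_simp
            _ ≤ (1 - ε) / 2 := ha.trans_le hεε₂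
        linarith
      · rw [← hνdef]
        have e1 : ν * (2 * m : ℕ) ≤ ν * (κ * u ^ 2 - C * u) := by gcongr
        have e2 : ν * (κ * u ^ 2 - C * u) = ℓ - (a + 2) * u := by
          rw [← hνt, ← hνC]
          ring
        linarith

theorem theorem4p7 (K k : ℕ) (hk : 1 ≤ k) (hkK : k < K) :
    (ExhibitsCutoff (largeGraphs.{u} K k) (fun ε X => X.1.nbrwMixingTime ε) ∧
      ∀ b : ℝ, 1 < b →
        CutoffAt (largeGraphs.{u} K k) (fun ε X => X.1.nbrwMixingTime ε)
          (fun X => Real.logb (√(K * k)) X.1.edgeCard)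
          (fun _ X => 3 * Real.logb (√(K * k)) (Real.logb b X.1.edgeCard))) ∧
    (ExhibitsCutoff (largeGraphs.{u} K k) (fun ε X => X.1.srwMixingTime ε) ∧
      ∃ w : ℝ → RamanujanBigraph.{u} K k → ℝ,
        CutoffAt (largeGraphs.{u} K k) (fun ε X => X.1.srwMixingTime ε)
          (fun X => ((K + 1 : ℝ) * (k + 1)) / (K * k - 1) *
            Real.logb (√(K * k)) X.1.leftCard) w ∧
        ∀ ε : ℝ, 0 < ε → ε < 1 →
          w ε =O[largeGraphs.{u} K k] fun X => √(Real.log X.1.leftCard)) := by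
  have hq1 := Real.sqrt_mul_natCast_gt_one hk hkK
  obtain ⟨c, hc⟩ := srw_cutoffAt.{u} hk hkK
  -- Any base b > 1 would serve here, since the ratio of mixing times does not involve the window.
  refine ⟨⟨exhibitsCutoff_of_cutoffAt ?_ (nbrw_cutoffAt hk hkK one_lt_two),
    fun b hb => nbrw_cutoffAt hk hkK hb⟩, exhibitsCutoff_of_cutoffAt ?_ hc, _, hc,
    fun ε _ _ => isBigO_const_mul_self _ _ _⟩
  · exact (Real.tendsto_logb_atTop hq1).comp (tendsto_edgeCard K k)
  · refine ((Real.tendsto_logb_atTop hq1).comp (tendsto_leftCard K k)).const_mul_atTop ?_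
    have := inv_pos.2 (speed_pos hk hkK)
    rwa [Bigraph.speed, inv_div] at this
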